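/- Fix a prime number $p$ and an integer $n\ge 2$. For a profinite group $G$: * the $p$-Zassenhaus filtration is defined by $G_{(1,p)}=G$ and, for $m\ge 2$, $G_{(m,p)}$ is the closed subgroup of $G$ generated by all $p$-th powers of elements of $G_{(\lceil m/p\rceil,p)}$ and all commutator subgroups $[G_{(i,p)},G_{(j,p)}]$ with $i,j\ge 1$, $i+j=m$; * $\mathbb U_m=\mathbb U_m(\mathbb Z/p)$ is the group of unipotent upper-triangular $(m+1)\times(m+1)$ matrices over $\mathbb Z/p$, and $T^{\mathbb U_m}(G)$ is the intersection of the kernels of all continuous homomorphisms $G\to\mathbb U_m$; * $\bar{\mathbb U}_n$ is the quotient of $\mathbb U_n$ by the central subgroup $\{I+rE_{1,n+1} : r\in\mathbb Z/p\}\cong\mathbb Z/p$, and $\alpha\in H^2(\bar{\mathbb U}_n,\mathbb Z/p)$ is the classifying element of the central extension $0\to\mathbb Z/p\to\mathbb U_n\to\bar{\mathbb U}_n\to 1$; * $H^i(G)$ is the continuous cohomology group $H^i(G,\mathbb Z/p)$ with trivial action. For $\varphi_1,\dots,\varphi_n\in H^1(G)=\mathrm{Hom}_{\mathrm{cont}}(G,\mathbb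 Z/p)$, the $n$-fold Massey product $\langle\varphi_1,\dots,\varphi_n\rangle\subseteq H^2(G)$ is the set of all pullbacks $\bar\rho^*(\alpha)$, where $\bar\rho\colon G\to\bar{\mathbb U}_n$ is a continuous homomorphism with $\bar\rho_{i,i+1}=\varphi_i$ for $i=1,\dots,n$; * $H^2(G)_{n\text{-Massey}}$ is the subgroup of $H^2(G)$ generated by all elements of $n$-fold Massey products. **Theorem.** Let $S$ be a free profinite group (on a basis, of any cardinality, converging to $1$), let $N$ be a closed normal subgroup of $S$ contained in $S_{(n,p)}$, and let $G=S/N$. Then: (a) $T^{\mathbb U_{n-1}}(G)=G_{(n,p)}$. (b) One has $T^{\mathbb U_n}(G)=G_{(n+1,p)}$ if and only if the kernel $$\mathrm{Ker}\bigl(H^2(G/G_{(n,p)})_{n\text{-Massey}}\xrightarrow{\ \inf\ }H^2(G)\bigr)$$ is generated, as a group, by elements of $n$-fold Massey products in $H^2(G/G_{(n,p)})$. -/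

import Mathlib

open Filter Topology

universe u v w

/-! ### Free profinite groups -/

/-- `S` is a free profinite group with basis `ι : X → S` converging to `1`: every neighbourhood of
`1` contains all but finitely many of the `ι x`, and every map from `X` to a profinite group which
converges to `1` in this sense extends uniquely to a continuous homomorphism. The basis may be
finite or infinite, of any cardinality. -/
structure IsFreeProfiniteOn {X : Type v} {S : Type u} [Group S] [TopologicalSpace S]
    (ι : X → S) : Prop where
  tendsto_one : Tendsto ι cofinite (𝓝 1)
  existsUnique_lift : ∀ (H : Type u) [Group H] [TopologicalSpace H] [IsTopologicalGroup H]
    [CompactSpace H] [T2Space H] [TotallyDisconnectedSpace H] (f : X → H),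
    Tendsto f cofinite (𝓝 1) → ∃! φ : S →ₜ* H, ∀ x, φ (ι x) = f x

/-! ### The Zassenhaus filtration -/

section Zassenhaus

lemma ceilDiv_prime_lt (p : ℕ) [hp : Fact p.Prime] (n : ℕ) : (n + 2) ⌈/⌉ p < n + 2 := by
  rw [Nat.ceilDiv_eq_add_pred_div, Nat.div_lt_iff_lt_mul hp.out.pos]
  obtain ⟨q, hq⟩ := Nat.exists_eq_add_of_le hp.out.two_le
  have : (n + 2) * p = 2 * n + n * q + 4 + 2 * q := by rw [hq]; ring
  omega

variable (p : ℕ) [Fact p.Prime] (G : Type u) [Group G] [TopologicalSpace G]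
  [IsTopologicalGroup G]

/-- The `p`-Zassenhaus filtration of a profinite group: `G_(1) = G`, and for `n ≥ 2` the subgroup
`G_(n)` is the closed subgroup generated by all `p`-th powers of elements of `G_(⌈n/p⌉)` and all
commutator subgroups `[G_(i), G_(j)]` with `i, j ≥ 1` and `i + j = n`.
(The value `G` at index `0` is a convention.) -/
def zassenhaus : ℕ → Subgroup G
  | 0 => ⊤
  | 1 => ⊤
  | n + 2 =>
    have := ceilDiv_prime_lt p n
    (Subgroup.closure {x | ∃ g ∈ zassenhaus ((n + 2) ⌈/⌉ p), x = g ^ p} ⊔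
      ⨆ i : Fin (n + 1), ⁅zassenhaus (i + 1), zassenhaus (n + 1 - i)⁆).topologicalClosure
  termination_by n => n
  decreasing_by all_goals omega

instance zassenhaus_normal (n : ℕ) : (zassenhaus p G n).Normal := by
  induction n using Nat.strong_induction_on with
  | _ n ih =>
    match n, ih with
    | 0, _ => rw [zassenhaus]; infer_instance
    | 1, _ => rw [zassenhaus]; infer_instance
    | n + 2, ih =>
      rw [zassenhaus]
      have h1 := ih _ (ceilDiv_prime_lt p n)
      have h2 : ∀ i : Fin (n + 1), (zassenhaus p G (i + 1)).Normal := fun i => ih _ (by omega)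
      have h3 : ∀ i : Fin (n + 1), (zassenhaus p G (n + 1 - i)).Normal :=
        fun i => ih _ (by omega)
      have h4 : (Subgroup.closure {x | ∃ g ∈ zassenhaus p G ((n + 2) ⌈/⌉ p), x = g ^ p}).Normal := by
        refine ⟨fun x hx a => ?_⟩
        induction hx using Subgroup.closure_induction with
        | mem x hx =>
          obtain ⟨g, hg, rfl⟩ := hx
          exact Subgroup.subset_closure ⟨a * g * a⁻¹, h1.conj_mem g hg a, conj_pow.symm⟩
        | one => simp
        | mul x y _ _ hx hy => rw [← conj_mul]; exact mul_mem hx hy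
        | inv x _ hx => rw [← conj_inv]; exact inv_mem hx
      exact Subgroup.is_normal_topologicalClosure _

end Zassenhaus

/-! ### Intersections of kernels -/

/-- `T^U(G)`: the intersection of the kernels of all continuous homomorphisms `G → U`. -/
def homKernel (U : Type w) [Group U] [TopologicalSpace U] (G : Type u) [Group G]
    [TopologicalSpace G] : Subgroup G :=
  ⨅ ρ : G →ₜ* U, (ρ : G →* U).ker

/-! ### Unitriangular groups -/

section Unitriangular

variable (n : ℕ) (R : Type u) [CommRing R]

/-- The unipotent upper-triangular `(n+1) × (n+1)` matrices over `R`, inside `GL_{n+1}(R)`. -/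
def unitriangularSubgroup : Subgroup (Matrix (Fin (n + 1)) (Fin (n + 1)) R)ˣ where
  carrier := {M | (∀ i j, j < i → M.1 i j = 0) ∧ ∀ i, M.1 i i = 1}
  one_mem' := ⟨fun i j h => Matrix.one_apply_ne h.ne', fun i => Matrix.one_apply_eq i⟩
  mul_mem' := by
    rintro M N ⟨hM, hM'⟩ ⟨hN, hN'⟩
    refine ⟨fun i j h => ?_, fun i => ?_⟩
    · rw [Units.val_mul, Matrix.mul_apply]
      refine Finset.sum_eq_zero fun k _ => ?_
      rcases lt_or_ge k i with h1 | h1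
      · rw [hM i k h1, zero_mul]
      · rw [hN k j (h.trans_le h1), mul_zero]
    · rw [Units.val_mul, Matrix.mul_apply, Finset.sum_eq_single i, hM', hN', one_mul]
      · intro k _ hk
        rcases lt_or_gt_of_ne hk with h1 | h1
        · rw [hM i k h1, zero_mul]
        · rw [hN k i h1, mul_zero]
      · simp
  inv_mem' := by
    rintro M ⟨hM, hM'⟩
    have htri : ∀ i j, j < i → (M⁻¹).1 i j = 0 := by
      have hbt : Matrix.BlockTriangular M.1 id := fun i j h => hM i j h
      let _ : Invertible M.1 := M.isUnit.invertible
      have := Matrix.blockTriangular_inv_of_blockTriangular hbt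
      intro i j h
      rw [Matrix.coe_units_inv]
      exact this h
    refine ⟨htri, fun i => ?_⟩
    have h : (M.1 * (M⁻¹).1) i i = 1 := by rw [Units.mul_inv, Matrix.one_apply_eq]
    rw [Matrix.mul_apply, Finset.sum_eq_single i, hM', one_mul] at h
    · exact h
    · intro k _ hk
      rcases lt_or_gt_of_ne hk with h1 | h1
      · rw [hM i k h1, zero_mul]
      · rw [htri k i h1, mul_zero]
    · simp

/-- The group `U_n(R)` of unipotent upper-triangular `(n+1) × (n+1)` matrices over `R`. It carries
the discrete topology, and is only used for finite rings `R`. -/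
def Unitriangular : Type u := unitriangularSubgroup n R

namespace Unitriangular

instance : Group (Unitriangular n R) := inferInstanceAs (Group (unitriangularSubgroup n R))

instance : TopologicalSpace (Unitriangular n R) := ⊥

instance : DiscreteTopology (Unitriangular n R) := ⟨rfl⟩

variable {n R}

/-- The underlying matrix. -/
def val (M : Unitriangular n R) : Matrix (Fin (n + 1)) (Fin (n + 1)) R := M.1.1

lemma val_one : val (1 : Unitriangular n R) = 1 := rfl

lemma val_mul (M N : Unitriangular n R) : val (M * N) = val M * val N := rfl

lemma val_apply_of_lt (M : Unitriangular n R) {i j : Fin (n + 1)} (h : j < i) : val M i j = 0 :=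
  M.2.1 i j h

lemma val_apply_self (M : Unitriangular n R) (i : Fin (n + 1)) : val M i i = 1 := M.2.2 i

variable (n R)

/-- The subgroup `R⁺` of `U_n(R)`, consisting of the matrices `I + r E_{1,n+1}`, i.e. of the
matrices which agree with the identity matrix outside the upper-right corner. -/
def corner : Subgroup (Unitriangular n R) where
  carrier := {M | ∀ i j, ¬ (i = 0 ∧ j = Fin.last n) → val M i j = (1 : Matrix _ _ R) i j}
  one_mem' := fun _ _ _ => rfl
  mul_mem' := by
    intro M N hM hN i j hij
    rw [val_mul, Matrix.mul_apply]
    by_cases hi : i = 0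
    · have hj : j ≠ Fin.last n := fun h => hij ⟨hi, h⟩
      rw [Finset.sum_congr rfl fun k _ => by rw [hN k j (fun h => hj h.2)]]
      rw [← Matrix.mul_apply, mul_one, hM i j hij]
    · rw [Finset.sum_congr rfl fun k _ => by rw [hM i k (fun h => hi h.1)]]
      rw [← Matrix.mul_apply, one_mul, hN i j hij]
  inv_mem' := by
    intro M hM i j hij
    by_cases hi : i = 0
    · have hj : j ≠ Fin.last n := fun h => hij ⟨hi, h⟩
      have h : val (M⁻¹ * M) i j = (1 : Matrix _ _ R) i j := by rw [inv_mul_cancel, val_one]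
      rw [val_mul, Matrix.mul_apply,
        Finset.sum_congr rfl fun k _ => by rw [hM k j (fun h => hj h.2)],
        ← Matrix.mul_apply, mul_one] at h
      exact h
    · have h : val (M * M⁻¹) i j = (1 : Matrix _ _ R) i j := by rw [mul_inv_cancel, val_one]
      rw [val_mul, Matrix.mul_apply,
        Finset.sum_congr rfl fun k _ => by rw [hM i k (fun h => hi h.1)],
        ← Matrix.mul_apply, one_mul] at h
      exact h

variable {n R}

lemma ext_val {M N : Unitriangular n R} (h : val M = val N) : M = N :=
  Subtype.ext (Units.ext h)

/-- The corner subgroup is central. -/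
lemma corner_comm {z : Unitriangular n R} (hz : z ∈ corner n R) (M : Unitriangular n R) :
    z * M = M * z := by
  apply ext_val
  rw [val_mul, val_mul, ← sub_eq_zero]
  have hz' : ∀ i j, ¬ (i = 0 ∧ j = Fin.last n) → (val z - 1) i j = 0 := fun i j h => by
    rw [Matrix.sub_apply, hz i j h, sub_self]
  have key : val z * val M - val M * val z
      = (val z - 1) * val M - val M * (val z - 1) := by noncomm_ring
  rw [key, sub_eq_zero]
  ext i j
  rw [Matrix.mul_apply, Matrix.mul_apply, Finset.sum_eq_single (Fin.last n),
    Finset.sum_eq_single (0 : Fin (n + 1))]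
  · by_cases hij : i = 0 ∧ j = Fin.last n
    · rw [hij.1, hij.2, val_apply_self, val_apply_self, mul_one, one_mul]
    · by_cases hi : i = 0
      · have hj : j ≠ Fin.last n := fun h => hij ⟨hi, h⟩
        rw [val_apply_of_lt M (lt_of_le_of_ne (Fin.le_last j) hj), hz' 0 j (fun h => hj h.2),
          mul_zero, mul_zero]
      · rw [val_apply_of_lt M (Fin.pos_of_ne_zero hi), hz' i _ (fun h => hi h.1),
          zero_mul, zero_mul]
  · intro k _ hk
    rw [hz' k j (fun h => hk h.1), mul_zero]
  · simp
  · intro k _ hk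
    rw [hz' i k (fun h => hk h.2), zero_mul]
  · simp

instance corner_normal : (corner n R).Normal :=
  ⟨fun z hz M => by rw [← corner_comm hz M, mul_inv_cancel_right]; exact hz⟩

/-- The coordinate `r` of the matrix `I + r E_{1,n+1}`; on `corner n R` it is the identification
of that subgroup with the additive group of `R`. -/
def cornerCoord (z : Unitriangular n R) : R := (val z - 1) 0 (Fin.last n)

lemma cornerCoord_one : cornerCoord (1 : Unitriangular n R) = 0 := by
  simp [cornerCoord, val_one]

lemma cornerCoord_mul {z w : Unitriangular n R} (hz : z ∈ corner n R) (hw : w ∈ corner n R) :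
    cornerCoord (z * w) = cornerCoord z + cornerCoord w := by
  have key : val (z * w) - 1 = (val z - 1) + (val w - 1) + (val z - 1) * (val w - 1) := by
    rw [val_mul]; noncomm_ring
  have h0 : ((val z - 1) * (val w - 1)) 0 (Fin.last n) = 0 := by
    rw [Matrix.mul_apply]
    refine Finset.sum_eq_zero fun k _ => ?_
    by_cases hk : k = 0
    · subst hk
      by_cases hl : (0 : Fin (n + 1)) = Fin.last n
      · rw [Matrix.sub_apply, val_apply_self, Matrix.one_apply_eq, sub_self, zero_mul]
      · rw [Matrix.sub_apply, hz 0 0 (fun h => hl h.2), sub_self, zero_mul]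
    · rw [Matrix.sub_apply (val w), hw k _ (fun h => hk h.1), sub_self, mul_zero]
  rw [cornerCoord, key, Matrix.add_apply, Matrix.add_apply, h0, add_zero]
  rfl

variable (n R)

/-- The quotient `Ū_n(R) = U_n(R) / R⁺`. -/
abbrev Bar : Type u := Unitriangular n R ⧸ corner n R

instance : DiscreteTopology (Bar n R) :=
  QuotientGroup.discreteTopology (isOpen_discrete _)

end Unitriangular

end Unitriangular

/-! ### Second cohomology of profinite groups -/

section Cohomology

variable (G : Type u) [Group G] [TopologicalSpace G] [IsTopologicalGroup G]
  (A : Type w) [AddCommGroup A] [TopologicalSpace A] [IsTopologicalAddGroup A]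

/-- Continuous inhomogeneous 2-cocycles of `G` with values in `A`, with the trivial action. -/
def cocycles2 : AddSubgroup C(G × G, A) where
  carrier := {f | ∀ a b c, f (b, c) - f (a * b, c) + f (a, b * c) - f (a, b) = 0}
  zero_mem' := by simp
  add_mem' := by
    intro f g hf hg a b c
    have h := congrArg₂ (· + ·) (hf a b c) (hg a b c)
    simp only [ContinuousMap.add_apply, add_zero] at h ⊢
    rw [← h]; abel
  neg_mem' := by
    intro f hf a b c
    have h := congrArg Neg.neg (hf a b c)
    simp only [ContinuousMap.neg_apply, neg_zero] at h ⊢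
    rw [← h]; abel

/-- The 2-coboundaries: the functions `(a, b) ↦ φ b - φ (a * b) + φ a` with `φ : G → A`
continuous. -/
def coboundaries2 : AddSubgroup C(G × G, A) where
  carrier := {f | ∃ φ : C(G, A), ∀ a b, f (a, b) = φ b - φ (a * b) + φ a}
  zero_mem' := ⟨0, by simp⟩
  add_mem' := by
    rintro f g ⟨φ, hφ⟩ ⟨ψ, hψ⟩
    refine ⟨φ + ψ, fun a b => ?_⟩
    simp only [ContinuousMap.add_apply, hφ, hψ]; abel
  neg_mem' := by
    rintro f ⟨φ, hφ⟩
    refine ⟨-φ, fun a b => ?_⟩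
    simp only [ContinuousMap.neg_apply, hφ]; abel

/-- Every coboundary is a cocycle. -/
lemma coboundaries2_le_cocycles2 : coboundaries2 G A ≤ cocycles2 G A := by
  rintro f ⟨φ, hφ⟩ a b c
  simp only [hφ, mul_assoc]; abel

/-- The second continuous cohomology group `H²(G, A)` with the trivial action on `A`. -/
abbrev ContH2 : Type _ := cocycles2 G A ⧸ (coboundaries2 G A).addSubgroupOf (cocycles2 G A)

variable {G A} {H : Type v} [Group H] [TopologicalSpace H] [IsTopologicalGroup H]

/-- Pullback of 2-cocycles along a continuous homomorphism. -/
def cocycles2Pullback (φ : G →ₜ* H) : cocycles2 H A →+ cocycles2 G A where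
  toFun f := ⟨⟨fun x => f.1 (φ x.1, φ x.2), by fun_prop⟩, fun a b c => by
    simpa using f.2 (φ a) (φ b) (φ c)⟩
  map_zero' := rfl
  map_add' _ _ := rfl

/-- The pullback map `φ^* : H²(H, A) → H²(G, A)` of a continuous homomorphism `φ : G → H`. -/
def ContH2.pullback (φ : G →ₜ* H) : ContH2 H A →+ ContH2 G A :=
  QuotientAddGroup.map _ _ (cocycles2Pullback φ) (by
    rintro f ⟨ψ, hψ⟩
    exact ⟨⟨fun x => ψ (φ x), by fun_prop⟩, fun a b => by
      have h := hψ (φ a) (φ b)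
      rw [← map_mul] at h
      exact h⟩)

/-- The natural projection `G → G ⧸ N`, as a continuous homomorphism. -/
def quotientProj (N : Subgroup G) [N.Normal] : G →ₜ* G ⧸ N where
  toMonoidHom := QuotientGroup.mk' N
  continuous_toFun := QuotientGroup.continuous_mk

/-- The inflation map `H²(G ⧸ N, A) → H²(G, A)`. -/
def ContH2.inf (N : Subgroup G) [N.Normal] : ContH2 (G ⧸ N) A →+ ContH2 G A :=
  ContH2.pullback (quotientProj N)

end Cohomology

/-! ### The classifying element and Massey products -/

namespace Unitriangular

section Classifying

variable (n : ℕ) (R : Type u) [CommRing R]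

variable {n R} in
/-- The factor set `s(x) s(y) s(xy)⁻¹` of a set-theoretic section `s` lies in `R⁺`. -/
lemma factorSet_mem {s : Bar n R → Unitriangular n R} (hs : ∀ x, (s x : Bar n R) = x)
    (x y : Bar n R) : s x * s y * (s (x * y))⁻¹ ∈ corner n R := by
  rw [← QuotientGroup.eq_one_iff]
  simp [hs]

variable {n R} in
/-- The factor set of the central extension `0 → R⁺ → U_n(R) → Ū_n(R) → 1` attached to a
set-theoretic section `s`, as a 2-cocycle with values in `R`:
`(x, y) ↦ s(x) s(y) s(xy)⁻¹ ∈ R⁺`. -/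
def factorSet (s : Bar n R → Unitriangular n R) (hs : ∀ x, (s x : Bar n R) = x)
    [TopologicalSpace R] [IsTopologicalAddGroup R] : cocycles2 (Bar n R) R :=
  ⟨⟨fun x => cornerCoord (s x.1 * s x.2 * (s (x.1 * x.2))⁻¹), continuous_of_discreteTopology⟩, by
    intro a b c
    simp only [ContinuousMap.coe_mk]
    have h1 := cornerCoord_mul (factorSet_mem hs a b) (factorSet_mem hs (a * b) c)
    have h2 := cornerCoord_mul (factorSet_mem hs b c) (factorSet_mem hs a (b * c))
    have h3 : s a * s b * (s (a * b))⁻¹ * (s (a * b) * s c * (s (a * b * c))⁻¹) =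
        s b * s c * (s (b * c))⁻¹ * (s a * s (b * c) * (s (a * (b * c)))⁻¹) := by
      have h4 := corner_comm (factorSet_mem hs b c) (s a)
      calc _ = s a * (s b * s c * (s (b * c))⁻¹) * s (b * c) * (s (a * b * c))⁻¹ := by group
        _ = _ := by rw [← h4, mul_assoc a b c]; group
    rw [h3, h2] at h1
    rw [sub_add_eq_add_sub, sub_sub, sub_eq_zero, h1, add_comm]⟩

/-- The classifying element `α ∈ H²(Ū_n(R), R⁺)` of the central extension
`0 → R⁺ → U_n(R) → Ū_n(R) → 1`, i.e. the class of the factor set of a section. -/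
noncomputable def classifyingElement [TopologicalSpace R] [IsTopologicalAddGroup R] : ContH2 (Bar n R) R :=
  QuotientAddGroup.mk (factorSet (Quotient.out : Bar n R → Unitriangular n R)
    QuotientGroup.out_eq')

/-- The classifying element may be computed from any section. -/
lemma classifyingElement_eq [TopologicalSpace R] [IsTopologicalAddGroup R] (s : Bar n R → Unitriangular n R)
    (hs : ∀ x, (s x : Bar n R) = x) :
    classifyingElement n R = QuotientAddGroup.mk (factorSet s hs) := by
  have main : ∀ (t : Bar n R → Unitriangular n R) (ht : ∀ x, (t x : Bar n R) = x),
      (QuotientAddGroup.mk (factorSet t ht) : ContH2 (Bar n R) R) =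
        QuotientAddGroup.mk (factorSet s hs) := by
    intro t ht
    have hz : ∀ x, s x * (t x)⁻¹ ∈ corner n R := fun x => by
      rw [← QuotientGroup.eq_one_iff]
      simp [hs, ht]
    refine QuotientAddGroup.eq.2 ⟨⟨fun x => cornerCoord (s x * (t x)⁻¹),
      continuous_of_discreteTopology⟩, fun a b => ?_⟩
    have h : s a * (t a)⁻¹ * (s b * (t b)⁻¹) * (t a * t b * (t (a * b))⁻¹) =
        s a * s b * (s (a * b))⁻¹ * (s (a * b) * (t (a * b))⁻¹) := by
      have h4 := corner_comm (hz b) (t a)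
      calc _ = s a * (t a)⁻¹ * (s b * (t b)⁻¹ * t a) * t b * (t (a * b))⁻¹ := by group
        _ = _ := by rw [h4]; group
    have h' := congrArg cornerCoord h
    rw [cornerCoord_mul (mul_mem (hz a) (hz b)) (factorSet_mem ht a b),
      cornerCoord_mul (hz a) (hz b),
      cornerCoord_mul (factorSet_mem hs a b) (hz (a * b))] at h'
    change -cornerCoord (t a * t b * (t (a * b))⁻¹) + cornerCoord (s a * s b * (s (a * b))⁻¹) =
      cornerCoord (s b * (t b)⁻¹) - cornerCoord (s (a * b) * (t (a * b))⁻¹)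
        + cornerCoord (s a * (t a)⁻¹)
    rw [← sub_eq_zero] at h' ⊢
    rw [← neg_eq_zero, ← h']
    abel
  exact main _ _

end Classifying

end Unitriangular

section Massey

variable (n p : ℕ) (G : Type u) [Group G] [TopologicalSpace G] [IsTopologicalGroup G]

variable {n p G} in
/-- The `n`-fold Massey product `⟨φ₁, …, φₙ⟩ ⊆ H²(G, ℤ/p)` of `φ₁, …, φₙ ∈ H¹(G, ℤ/p)`
(for `n ≥ 2`): the set of all pullbacks `ρ^*(α)` of the classifying element `α` along the continuous
homomorphisms `ρ : G → Ū_n(ℤ/p)` whose `(i, i+1)` entries are the `φᵢ`. -/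
def masseyProduct (φ : Fin n → (G →ₜ* Multiplicative (ZMod p))) : Set (ContH2 G (ZMod p)) :=
  {x | ∃ ρ : G →ₜ* Unitriangular.Bar n (ZMod p),
    (∀ (g : G) (M : Unitriangular n (ZMod p)), (M : Unitriangular.Bar n (ZMod p)) = ρ g →
      ∀ i : Fin n, M.val i.castSucc i.succ = (φ i g).toAdd) ∧
    x = ContH2.pullback ρ (Unitriangular.classifyingElement n (ZMod p))}

/-- The set of all elements of `n`-fold Massey products in `H²(G, ℤ/p)`. -/
def masseyElements : Set (ContH2 G (ZMod p)) :=
  ⋃ φ : Fin n → (G →ₜ* Multiplicative (ZMod p)), masseyProduct φ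

/-- `H²(G, ℤ/p)_{n-Massey}`: the subgroup generated by all elements of `n`-fold Massey products. -/
def masseySubgroup : AddSubgroup (ContH2 G (ZMod p)) :=
  AddSubgroup.closure (masseyElements n p G)

end Massey

set_option linter.unusedSectionVars false

open scoped commutatorElement

/-! Write `G_k` for the Zassenhaus filtration and `T_n` for the intersection of the kernels of the
homomorphisms to `U_n`. Everything rests on the equality `T_n(S) = S_(n+1)` for free `S`
(`IsFreeProfiniteOn.homKernel_unitriangular`). The matrices `I + A` with `A` vanishing below the
`k`-th superdiagonal form a restricted filtration of `U_n` that is trivial in degree `n + 1`, and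
the Zassenhaus filtration is the least closed one; this gives `⊇`. Conversely, Magnus coefficients
at words of length at most `n` are matrix entries of representations into `U_n`. If all these
representations kill `s`, then in a suitable finite quotient `s - 1` has degree `n + 1` in the
filtered group algebra, and Jennings' theorem (`AugPow.mem_of_sub_one`) puts `s` in weight `n + 1`.
Part (a) follows because homomorphisms `S → U_(n-1)` kill `S_n`, hence `N`.

For (b), `Q = G/G_n` is also `S/S_n`. A class on `Q` with trivial inflation to `Γ` (`G` or `S`) is
the transgression of a character of `Γ_n`, and class and character determine each other
(`IsTransgression`). A Massey element dies in `H²(Γ)` exactly when its homomorphism to `Ū_n` lifts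
to `Γ → U_n`, and its character is then minus the corner coordinate of the lift. Finite-dimensional
duality and compactness (`exists_mem_eqOn`) identify the group generated by such elements with the
characters of `Γ_n` trivial on `T_n(Γ)`.

Over `S` every Massey element dies, so the Massey subgroup corresponds to the characters of `S_n`
trivial on `T_n(S) = S_(n+1)`. Those of its classes that die in `H²(G)` are the ones whose character
descends to `G_n`; they correspond to the characters of `G_n` trivial on `G_(n+1)`. The kernel is
therefore generated by Massey elements iff the characters trivial on `G_(n+1)` are those trivial on
`T_n(G)`, that is, iff the two subgroups agree. -/

/-! ### Linear forms on elementary abelian sections -/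

section Duality

variable {p : ℕ} [Fact p.Prime]

/-- A nontrivial element of an elementary abelian `p`-group is sent to `1` by some homomorphism to
`ℤ/p`. -/
lemma exists_hom_zmod_eq_one {V : Type*} [CommGroup V] (hV : ∀ x : V, x ^ p = 1) {v : V}
    (hv : v ≠ 1) : ∃ f : V →* Multiplicative (ZMod p), f v = Multiplicative.ofAdd 1 := by
  let _ : Module (ZMod p) (Additive V) := AddCommGroup.zmodModule (n := p) hV
  obtain ⟨f, hf⟩ := Module.Projective.exists_dual_ne_zero (ZMod p)
    (x := Additive.ofMul v) (fun h => hv (Additive.ofMul.injective h))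
  refine ⟨AddMonoidHom.toMultiplicativeRight (((f (Additive.ofMul v))⁻¹ • f).toAddMonoidHom), ?_⟩
  exact congrArg Multiplicative.ofAdd (inv_mul_cancel₀ hf)

/-- If `K / B` is an elementary abelian `p`-group, then an element of `K` outside `B` is sent to `1`
by some homomorphism `K → ℤ/p` which is trivial on `B`. -/
lemma exists_additive_form {Γ : Type*} [Group Γ] {K B : Subgroup Γ}
    (hpow : ∀ a ∈ K, a ^ p ∈ B) (hcomm : ∀ a ∈ K, ∀ b ∈ K, ⁅a, b⁆ ∈ B)
    (hBK : B ≤ K) {s : Γ} (hs : s ∈ K) (hsB : s ∉ B) :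
    ∃ θ : Γ → ZMod p, (∀ a ∈ K, ∀ b ∈ K, θ (a * b) = θ a + θ b) ∧ (∀ b ∈ B, θ b = 0) ∧
      θ s = 1 := by
  classical
  let B' : Subgroup K := B.subgroupOf K
  have hB' : ∀ a b : K, ⁅a, b⁆ ∈ B' := fun a b => hcomm a a.2 b b.2
  have hn : B'.Normal := ⟨fun b hb a => by
    have h := mul_mem (hB' a b) hb
    rwa [commutatorElement_def, inv_mul_cancel_right] at h⟩
  let _ : CommGroup (K ⧸ B') :=
    { (inferInstance : Group (K ⧸ B')) with
      mul_comm := by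
        intro x y
        induction x using QuotientGroup.induction_on with | H a =>
        induction y using QuotientGroup.induction_on with | H b =>
        have h : ((⁅a, b⁆ : K) : K ⧸ B') = 1 := (QuotientGroup.eq_one_iff _).2 (hB' a b)
        rw [commutatorElement_def, QuotientGroup.mk_mul, QuotientGroup.mk_mul, QuotientGroup.mk_inv,
          QuotientGroup.mk_inv, QuotientGroup.mk_mul, mul_inv_eq_one, mul_inv_eq_iff_eq_mul] at h
        exact h }
  obtain ⟨f, hf⟩ := exists_hom_zmod_eq_one (p := p) (V := K ⧸ B') (by
    intro y
    induction y using QuotientGroup.induction_on with | H a =>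
    exact (QuotientGroup.eq_one_iff _).2 (hpow a a.2)) (v := ((⟨s, hs⟩ : K) : K ⧸ B'))
    (fun h => hsB ((QuotientGroup.eq_one_iff (N := B') _).1 h))
  -- The value `0` outside `K` is arbitrary: additivity is only claimed on `K`.
  refine ⟨fun g => if h : g ∈ K then (f ((⟨g, h⟩ : K) : K ⧸ B')).toAdd else 0,
    fun a ha b hb => ?_, fun b hb => ?_, ?_⟩
  · simp only [dif_pos (mul_mem ha hb), dif_pos ha, dif_pos hb]
    exact congrArg Multiplicative.toAdd
      (map_mul f ((⟨a, ha⟩ : K) : K ⧸ B') ((⟨b, hb⟩ : K) : K ⧸ B'))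
  · have h : (((⟨b, hBK hb⟩ : K)) : K ⧸ B') = 1 := (QuotientGroup.eq_one_iff _).2 hb
    simp only [dif_pos (hBK hb), h]
    exact congrArg Multiplicative.toAdd (map_one f)
  · simp only [dif_pos hs, hf]
    rfl

end Duality

/-! ### The theorem of Jennings -/

/-- A descending filtration of a group with `[F i, F j] ≤ F (i + j)` and `(F i)^p ⊆ F (p * i)`. -/
structure IsRestrictedFiltration (p : ℕ) {P : Type*} [Group P] (F : ℕ → Subgroup P) : Prop where
  one_eq_top : F 1 = ⊤
  antitone : Antitone F
  commutator_le : ∀ i j, ⁅F i, F j⁆ ≤ F (i + j)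
  pow_mem : ∀ i, ∀ g ∈ F i, g ^ p ∈ F (p * i)

lemma IsRestrictedFiltration.zero_eq_top {p : ℕ} {P : Type*} [Group P] {F : ℕ → Subgroup P}
    (hF : IsRestrictedFiltration p F) : F 0 = ⊤ :=
  top_le_iff.1 (hF.one_eq_top.symm.trans_le (hF.antitone zero_le_one))

section Jennings

variable {p : ℕ} [Fact p.Prime] {P : Type*} [Group P]

/-- `AugPow p F H k a`: the element `a` of the group algebra of `P` lies in the span of the products
`(g₁ - 1) ⋯ (gᵣ - 1)` with `gᵢ ∈ H ∩ F vᵢ` and `v₁ + ⋯ + vᵣ ≥ k`. -/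
inductive AugPow (p : ℕ) (F : ℕ → Subgroup P) (H : Subgroup P) :
    ℕ → MonoidAlgebra (ZMod p) P → Prop
  | zero (k : ℕ) : AugPow p F H k 0
  | one : AugPow p F H 0 1
  | add {k : ℕ} {a b} : AugPow p F H k a → AugPow p F H k b → AugPow p F H k (a + b)
  | smul {k : ℕ} (c : ZMod p) {a} : AugPow p F H k a → AugPow p F H k (c • a)
  | cons {k v j : ℕ} {g b} : g ∈ H → g ∈ F v → AugPow p F H j b → k ≤ v + j →
      AugPow p F H k ((MonoidAlgebra.of (ZMod p) P g - 1) * b)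

namespace AugPow

variable {F : ℕ → Subgroup P} {H : Subgroup P} {k l : ℕ} {a b : MonoidAlgebra (ZMod p) P}

local notation "δ" => MonoidAlgebra.of (ZMod p) P

lemma mono (h : AugPow p F H k a) (hl : l ≤ k) : AugPow p F H l a := by
  induction h generalizing l with
  | zero => exact zero _
  | one => rw [Nat.le_zero.1 hl]; exact one
  | add _ _ h1 h2 => exact add (h1 hl) (h2 hl)
  | smul c _ h => exact smul c (h hl)
  | cons hg hv hb hk _ => exact cons hg hv hb (hl.trans hk)

lemma mul (ha : AugPow p F H k a) (hb : AugPow p F H l b) : AugPow p F H (k + l) (a * b) := by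
  induction ha with
  | zero => rw [zero_mul]; exact zero _
  | one => rwa [one_mul, zero_add]
  | add _ _ h1 h2 => rw [add_mul]; exact add h1 h2
  | smul c _ h => rw [smul_mul_assoc]; exact smul c h
  | cons hg hv _ hk h => rw [mul_assoc]; exact cons hg hv h (by omega)

lemma of_sub_one {g : P} (hg : g ∈ H) (hk : g ∈ F k) : AugPow p F H k (δ g - 1) := by
  simpa using cons hg hk one (le_refl _)

lemma of_mem (hF : IsRestrictedFiltration p F) {g : P} (hg : g ∈ H) : AugPow p F H 0 (δ g) := by
  have h := add (of_sub_one (p := p) (k := 0) hg (hF.zero_eq_top ▸ Subgroup.mem_top g)) one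
  rwa [sub_add_cancel] at h

/-- Allows linear identities on such elements to be checked on group elements of `H` only. -/
lemma mem_span (h : AugPow p F H k a) : a ∈ Submodule.span (ZMod p) (δ '' (H : Set P)) := by
  induction h with
  | zero => exact zero_mem _
  | one => exact Submodule.subset_span ⟨1, H.one_mem, map_one _⟩
  | add _ _ h1 h2 => exact add_mem h1 h2
  | smul c _ h => exact Submodule.smul_mem _ c h
  | cons hg _ _ _ h =>
    rw [sub_mul, one_mul]
    refine sub_mem ?_ h
    clear * - hg h
    induction h using Submodule.span_induction with
    | mem x hx =>
      obtain ⟨y, hy, rfl⟩ := hx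
      exact Submodule.subset_span ⟨_, mul_mem hg hy, map_mul _ _ _⟩
    | zero => rw [mul_zero]; exact zero_mem _
    | add x y _ _ h1 h2 => rw [mul_add]; exact add_mem h1 h2
    | smul c x _ h => rw [mul_smul_comm]; exact Submodule.smul_mem _ c h

/-- Conjugation by an element of weight `w` raises the degree by `w` up to the identity. -/
lemma conj (hF : IsRestrictedFiltration p F) {x : P} {w : ℕ} (hx : x ∈ F w)
    (hxH : ∀ h ∈ H, x⁻¹ * h * x ∈ H) (ha : AugPow p F H k a) :
    AugPow p F H k (δ x⁻¹ * a * δ x) ∧ AugPow p F H (k + w) (δ x⁻¹ * a * δ x - a) := by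
  have hxx : δ x⁻¹ * δ x = 1 := by rw [← map_mul, inv_mul_cancel, map_one]
  have hxx' : δ x * δ x⁻¹ = 1 := by rw [← map_mul, mul_inv_cancel, map_one]
  induction ha with
  | zero => simp [zero]
  | one => rw [mul_one, hxx, sub_self]; exact ⟨one, zero _⟩
  | add _ _ h1 h2 =>
    rw [mul_add, add_mul, add_sub_add_comm]
    exact ⟨add h1.1 h2.1, add h1.2 h2.2⟩
  | smul c _ h =>
    rw [mul_smul_comm, smul_mul_assoc, ← smul_sub]
    exact ⟨smul c h.1, smul c h.2⟩
  | @cons k v j g b hg hv hb hk h =>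
    have hc : x⁻¹ * g * x = g * ⁅g⁻¹, x⁻¹⁆ := by rw [commutatorElement_def]; group
    have hcH : ⁅g⁻¹, x⁻¹⁆ ∈ H := by
      have := mul_mem (inv_mem hg) (hxH g hg)
      rwa [hc, inv_mul_cancel_left] at this
    have hcF : ⁅g⁻¹, x⁻¹⁆ ∈ F (v + w) :=
      hF.commutator_le v w (Subgroup.commutator_mem_commutator (inv_mem hv) (inv_mem hx))
    have hgx : δ x⁻¹ * δ g * δ x = δ g * δ ⁅g⁻¹, x⁻¹⁆ := by simp only [← map_mul, hc]
    have e1 : δ x⁻¹ * ((δ g - 1) * b) * δ x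
        = (δ (x⁻¹ * g * x) - 1) * (δ x⁻¹ * b * δ x) := by
      calc _ = (δ x⁻¹ * δ g * (δ x * δ x⁻¹) - δ x⁻¹ * (1 : MonoidAlgebra (ZMod p) P)) * b * δ x := by
            rw [hxx']; noncomm_ring
        _ = (δ x⁻¹ * δ g * δ x - 1) * (δ x⁻¹ * b * δ x) := by noncomm_ring
        _ = _ := by simp only [map_mul]
    have hcv : x⁻¹ * g * x ∈ F v := by
      rw [hc]; exact mul_mem hv (hF.antitone (Nat.le_add_right v w) hcF)
    refine ⟨e1 ▸ cons (hxH g hg) hcv h.1 hk, ?_⟩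
    -- A Leibniz rule: one summand contains the commutator, whose weight is already `v + w`; the
    -- other is covered by induction.
    have e2 : δ x⁻¹ * ((δ g - 1) * b) * δ x - (δ g - 1) * b
        = δ g * ((δ ⁅g⁻¹, x⁻¹⁆ - 1) * (δ x⁻¹ * b * δ x))
          + (δ g - 1) * (δ x⁻¹ * b * δ x - b) := by
      rw [e1, hc, map_mul]; noncomm_ring
    rw [e2]
    refine add ?_ (cons hg hv h.2 (by omega))
    exact (mul (of_mem hF hg) (cons hcH hcF h.1 le_rfl)).mono (by omega)

end AugPow

/-- The span of the products `(x - 1)^e a` with `a` of degree `j` over `H` and `e * w + j ≥ k`. -/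
noncomputable def augSpan (p : ℕ) [Fact p.Prime] (F : ℕ → Subgroup P) (H : Subgroup P) (x : P) (w k : ℕ) :
    Submodule (ZMod p) (MonoidAlgebra (ZMod p) P) :=
  Submodule.span (ZMod p) {b | ∃ e j a, AugPow p F H j a ∧ k ≤ e * w + j ∧
    b = (MonoidAlgebra.of (ZMod p) P x - 1) ^ e * a}

namespace augSpan

variable {F : ℕ → Subgroup P} {H H' : Subgroup P} {x : P} {w k l : ℕ}
  {a b : MonoidAlgebra (ZMod p) P}

local notation "δ" => MonoidAlgebra.of (ZMod p) P

lemma mono (hl : l ≤ k) : augSpan p F H x w k ≤ augSpan p F H x w l := by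
  refine Submodule.span_mono ?_
  rintro b ⟨e, j, a, ha, hk, rfl⟩
  exact ⟨e, j, a, ha, hl.trans hk, rfl⟩

lemma sub_one_mul_mem (hb : b ∈ augSpan p F H x w k) :
    (δ x - 1) * b ∈ augSpan p F H x w (k + w) := by
  induction hb using Submodule.span_induction with
  | mem b hb =>
    obtain ⟨e, j, a, ha, hk, rfl⟩ := hb
    refine Submodule.subset_span ⟨e + 1, j, a, ha, by rw [add_one_mul]; omega, ?_⟩
    rw [pow_succ', mul_assoc]
  | zero => rw [mul_zero]; exact zero_mem _
  | add x y _ _ h1 h2 => rw [mul_add]; exact add_mem h1 h2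
  | smul c x _ h => rw [mul_smul_comm]; exact Submodule.smul_mem _ c h

lemma pow_sub_one_mul_mem (hb : b ∈ augSpan p F H x w k) (e : ℕ) :
    (δ x ^ e - 1) * b ∈ augSpan p F H x w (k + w) := by
  induction e with
  | zero => simp
  | succ e ih =>
    have h : (δ x ^ (e + 1) - 1) * b
        = (δ x - 1) * ((δ x ^ e - 1) * b) + (δ x - 1) * b + (δ x ^ e - 1) * b := by
      rw [pow_succ']; noncomm_ring
    rw [h]
    exact add_mem (add_mem (mono (by omega) (sub_one_mul_mem ih)) (sub_one_mul_mem hb)) ih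

/-- With `a' = x⁻¹ a x` one has `a (x - 1) = (x - 1) a' + (a' - a)`. So `a` can be moved to the
right past the powers of `x - 1` without loss of degree, since `a' - a` gains the weight `w` of the
factor it consumes. -/
lemma augPow_mul_mem (hF : IsRestrictedFiltration p F) (hx : x ∈ F w)
    (hxH : ∀ h ∈ H, x⁻¹ * h * x ∈ H) {i : ℕ} (ha : AugPow p F H i a)
    (hb : b ∈ augSpan p F H x w k) : a * b ∈ augSpan p F H x w (i + k) := by
  induction hb using Submodule.span_induction with
  | mem b hb =>
    obtain ⟨e, j, b, hb, hk, rfl⟩ := hb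
    suffices h : a * ((δ x - 1) ^ e * b) ∈ augSpan p F H x w (i + (e * w + j)) from
      mono (by omega) h
    clear hk
    induction e generalizing a i with
    | zero =>
      refine Submodule.subset_span ⟨0, i + j, a * b, ha.mul hb, by omega, by simp⟩
    | succ e ih =>
      have hxx' : δ x * δ x⁻¹ = 1 := by rw [← map_mul, mul_inv_cancel, map_one]
      have h : a * ((δ x - 1) ^ (e + 1) * b)
          = (δ x - 1) * ((δ x⁻¹ * a * δ x) * ((δ x - 1) ^ e * b))
            + (δ x⁻¹ * a * δ x - a) * ((δ x - 1) ^ e * b) := by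
        have h1 : (δ x - 1) * (δ x⁻¹ * a * δ x) + (δ x⁻¹ * a * δ x - a)
            = a * (δ x - 1) := by
          calc _ = (δ x * δ x⁻¹) * a * δ x - a := by noncomm_ring
            _ = _ := by rw [hxx']; noncomm_ring
        rw [← mul_assoc (δ x - 1), ← add_mul, h1, pow_succ']
        noncomm_ring
      obtain ⟨h1, h2⟩ := ha.conj hF hx hxH
      rw [h, add_one_mul]
      refine add_mem (mono ?_ (sub_one_mul_mem (ih h1))) (mono ?_ (ih h2)) <;> omega
  | zero => rw [mul_zero]; exact zero_mem _
  | add x y _ _ h1 h2 => rw [mul_add]; exact add_mem h1 h2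
  | smul c x _ h => rw [mul_smul_comm]; exact Submodule.smul_mem _ c h

/-- A factor `g - 1` with `g ∈ H` is moved past the powers of `x - 1`. If `g ∉ H`, its weight is at
most `w`, and writing `g = x ^ e * h` splits `g - 1` into terms through `x ^ e - 1` and `h - 1`,
each of which gains `w`. -/
lemma augPow_le (hF : IsRestrictedFiltration p F) (hx : x ∈ F w)
    (hxH : ∀ h ∈ H, x⁻¹ * h * x ∈ H) (hH : F (w + 1) ≤ H) (hHw : H ≤ F w)
    (hH' : ∀ g ∈ H', ∃ e : ℕ, ∃ h ∈ H, g = x ^ e * h) (ha : AugPow p F H' k a) :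
    a ∈ augSpan p F H x w k := by
  induction ha with
  | zero => exact zero_mem _
  | one => exact Submodule.subset_span ⟨0, 0, 1, .one, by simp, by simp⟩
  | add _ _ h1 h2 => exact add_mem h1 h2
  | smul c _ h => exact Submodule.smul_mem _ c h
  | @cons k v j g b hg hv hb hk h =>
    by_cases hgH : g ∈ H
    · exact mono hk (augPow_mul_mem hF hx hxH (AugPow.of_sub_one hgH hv) h)
    · have hvw : v ≤ w := by
        by_contra! hlt
        exact hgH (hH (hF.antitone hlt hv))
      obtain ⟨e, h', hh', rfl⟩ := hH' g hg
      have e1 : (δ (x ^ e * h') - 1) * b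
          = (δ x ^ e - 1) * (δ h' * b) + (δ h' - 1) * b := by
        rw [map_mul, map_pow]; noncomm_ring
      have h1 := augPow_mul_mem hF hx hxH (AugPow.of_mem hF hh') h
      rw [zero_add] at h1
      rw [e1]
      refine add_mem (mono ?_ (pow_sub_one_mul_mem h1 e))
        (mono ?_ (augPow_mul_mem hF hx hxH (AugPow.of_sub_one hh' (hHw hh')) h)) <;> omega

end augSpan

/-- The linear extension of a function on a monoid to its monoid algebra. -/
noncomputable def monoidAlgebraExtend {k M V : Type*} [CommSemiring k] [AddCommMonoid V] [Module k V]
    (f : M → V) : MonoidAlgebra k M →ₗ[k] V :=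
  Finsupp.linearCombination k f ∘ₗ (MonoidAlgebra.coeffLinearEquiv k).toLinearMap

lemma monoidAlgebraExtend_of {k M V : Type*} [CommSemiring k] [AddCommMonoid V] [Module k V]
    [Monoid M] (f : M → V) (m : M) : monoidAlgebraExtend f (MonoidAlgebra.of k M m) = f m := by
  simp [monoidAlgebraExtend]


/-! ### The inductive step: replacing `H'` by the kernel of a linear form -/

section Step

variable {F : ℕ → Subgroup P} {H H' : Subgroup P} {x : P} {w k : ℕ} {θ : P → ZMod p}
  {a b : MonoidAlgebra (ZMod p) P}

local notation "δ" => MonoidAlgebra.of (ZMod p) P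

/-- With `ε` the augmentation, `θ ((g - 1) b) = θ g * ε b`. If `b` has positive degree, `ε b = 0`;
otherwise `g` alone carries weight greater than `w`, so `θ g = 0`. -/
lemma AugPow.extend_eq_zero (hF1 : ∀ g ∈ F (w + 1), θ g = 0) (hF : Antitone F)
    (hθ : ∀ a ∈ H, ∀ b ∈ H, θ (a * b) = θ a + θ b) (hb : AugPow p F H k b) :
    (0 < k → monoidAlgebraExtend (fun _ : P => (1 : ZMod p)) b = 0) ∧
      (w < k → monoidAlgebraExtend θ b = 0) := by
  induction hb with
  | zero => simp
  | one => simp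
  | add _ _ h1 h2 =>
    exact ⟨fun h => by rw [map_add, h1.1 h, h2.1 h, add_zero],
      fun h => by rw [map_add, h1.2 h, h2.2 h, add_zero]⟩
  | smul c _ h1 =>
    exact ⟨fun h => by rw [map_smul, h1.1 h, smul_zero], fun h => by rw [map_smul, h1.2 h, smul_zero]⟩
  | @cons k v j g b hg hv hb hk h =>
    have key : monoidAlgebraExtend (fun _ : P => (1 : ZMod p)) ((δ g - 1) * b) = 0 ∧
        monoidAlgebraExtend θ ((δ g - 1) * b)
          = θ g * monoidAlgebraExtend (fun _ : P => (1 : ZMod p)) b := by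
      have hs := hb.mem_span
      clear h hb
      induction hs using Submodule.span_induction with
      | mem y hy =>
        obtain ⟨y, hy, rfl⟩ := hy
        rw [sub_mul, one_mul, ← map_mul, map_sub, map_sub]
        simp only [monoidAlgebraExtend_of]
        rw [hθ g hg y hy]
        simp
      | zero => simp
      | add y z _ _ h1 h2 =>
        rw [mul_add, map_add, map_add, map_add, h1.1, h1.2, h2.1, h2.2]
        exact ⟨add_zero _, (mul_add _ _ _).symm⟩
      | smul c y _ h1 =>
        rw [mul_smul_comm, map_smul, map_smul, map_smul, h1.1, h1.2]
        exact ⟨smul_zero _, (mul_smul_comm _ _ _).symm⟩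
    refine ⟨fun _ => key.1, fun hwk => ?_⟩
    rw [key.2]
    rcases Nat.eq_zero_or_pos j with rfl | hj
    · rw [hF1 g (hF (by omega) hv), zero_mul]
    · rw [h.1 hj, mul_zero]

/-- The projection `xⁱ h ↦ h` (for `0 ≤ i < p` and `θ h = 0`, where `θ x = 1`) maps the span of the
products `(x - 1)^e a` to the span of the elements `a` with the same weight. -/
lemma augSpan.augPow_extend (hF : IsRestrictedFiltration p F)
    (hθ : ∀ a ∈ H', ∀ b ∈ H', θ (a * b) = θ a + θ b) (hx : x ∈ H') (hxw : x ∈ F w) (hθx : θ x = 1)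
    (hH : ∀ g, g ∈ H ↔ g ∈ H' ∧ θ g = 0) (hb : b ∈ augSpan p F H x w k) :
    AugPow p F H k (monoidAlgebraExtend (fun g => δ ((x ^ (θ g).val)⁻¹ * g)) b) := by
  have hp : p.Prime := Fact.out
  have : CharP (MonoidAlgebra (ZMod p) P) p :=
    charP_of_injective_algebraMap (algebraMap (ZMod p) (MonoidAlgebra (ZMod p) P)).injective p
  have hxi : ∀ i : ℕ, θ (x ^ i) = i := by
    intro i
    induction i with
    | zero =>
      have := hθ 1 H'.one_mem 1 H'.one_mem
      simpa using this
    | succ i ih => rw [pow_succ, hθ _ (pow_mem hx i) _ hx, ih, hθx]; simp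
  have hxp : x ^ p ∈ H := (hH _).2 ⟨pow_mem hx p, by rw [hxi]; simp⟩
  have hpw : ∀ i < p, ∀ {l} a, AugPow p F H l a →
      monoidAlgebraExtend (fun g => δ ((x ^ (θ g).val)⁻¹ * g)) (δ x ^ i * a) = a := by
    intro i hi l a ha
    have hs := ha.mem_span
    clear ha
    induction hs using Submodule.span_induction with
    | mem y hy =>
      obtain ⟨y, hy, rfl⟩ := hy
      obtain ⟨hy1, hy2⟩ := (hH y).1 hy
      rw [← map_pow, ← map_mul, monoidAlgebraExtend_of, hθ _ (pow_mem hx i) _ hy1, hxi, hy2,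
        add_zero, ZMod.val_cast_of_lt hi, inv_mul_cancel_left]
    | zero => simp
    | add y z _ _ h1 h2 => rw [mul_add, map_add, h1, h2]
    | smul c y _ h => rw [mul_smul_comm, map_smul, h]
  induction hb using Submodule.span_induction with
  | mem b hb =>
    obtain ⟨e, j, a, ha, hk, rfl⟩ := hb
    induction e using Nat.strong_induction_on generalizing j a with
    | _ e ih =>
      rcases lt_or_ge e p with he | he
      · rcases Nat.eq_zero_or_pos e with rfl | he0
        · have ha' : AugPow p F H k a := ha.mono (by omega)
          have := hpw 0 hp.pos a ha'
          rw [pow_zero] at this ⊢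
          rwa [this]
        · have ha0 : AugPow p F H 0 a := ha.mono (Nat.zero_le _)
          -- For `0 < e < p` the projection kills `(x - 1) ^ e * a`: it sends every `x ^ i * a` with
          -- `i < p` to `a`, so an iterated difference vanishes. The shift `i` is there for the
          -- induction.
          have hz : ∀ d i, i + (d + 1) < p → monoidAlgebraExtend
              (fun g => δ ((x ^ (θ g).val)⁻¹ * g)) (δ x ^ i * ((δ x - 1) ^ (d + 1) * a)) = 0 := by
            intro d
            induction d with
            | zero =>
              intro i hi
              have h1 : δ x ^ i * ((δ x - 1) ^ (0 + 1) * a) = δ x ^ (i + 1) * a - δ x ^ i * a := by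
                rw [zero_add, pow_one, pow_succ]; noncomm_ring
              rw [h1, map_sub, hpw _ (by omega) a ha0, hpw _ (by omega) a ha0, sub_self]
            | succ d ihd =>
              intro i hi
              have h1 : δ x ^ i * ((δ x - 1) ^ (d + 1 + 1) * a)
                  = δ x ^ (i + 1) * ((δ x - 1) ^ (d + 1) * a)
                    - δ x ^ i * ((δ x - 1) ^ (d + 1) * a) := by
                rw [pow_succ' _ (d + 1), pow_succ (δ x) i]; noncomm_ring
              rw [h1, map_sub, ihd _ (by omega), ihd _ (by omega), sub_self]
          have := hz (e - 1) 0 (by omega)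
          rw [pow_zero, one_mul, Nat.sub_add_cancel he0] at this
          rw [this]
          exact .zero _
      · obtain ⟨d, rfl⟩ := Nat.exists_eq_add_of_le' he
        -- In characteristic `p`, `(x - 1) ^ p = x ^ p - 1` with `x ^ p` in `H` of weight `p * w`:
        -- the `p` factors become one factor over `H` of the same total weight.
        have h1 : (δ x - 1) ^ (d + p) * a = (δ x - 1) ^ d * ((δ (x ^ p) - 1) * a) := by
          rw [pow_add, mul_assoc, sub_pow_char_of_commute p (Commute.one_right _), one_pow, map_pow]
        rw [h1]
        refine ih d (by have := hp.pos; omega) (p * w + j) _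
          (.cons hxp (hF.pow_mem w x hxw) ha le_rfl) ?_
        rw [add_mul] at hk
        omega
  | zero => rw [map_zero]; exact .zero _
  | add y z _ _ h1 h2 => rw [map_add]; exact .add h1 h2
  | smul c y _ h => rw [map_smul]; exact .smul c h

/-- The theorem of Jennings: the elements `g` with `g - 1` of degree `k` are those of weight `k`. -/
theorem AugPow.mem_of_sub_one [Finite P] (hF : IsRestrictedFiltration p F) {n : ℕ}
    (hn : F n = ⊥) (m : ℕ) : ∀ w, 0 < w → n ≤ w + m → ∀ H : Subgroup P, F (w + 1) ≤ H → H ≤ F w →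
      ∀ k, ∀ g ∈ H, AugPow p F H k (δ g - 1) → g ∈ F k := by
  have hp : p.Prime := Fact.out
  -- `m` bounds the distance from `w` to `n`, where the filtration is trivial; for fixed `w` there
  -- is an inner induction on the order of `H'`.
  induction m with
  | zero =>
    intro w _ hw H _ hHw k g hg _
    have : g ∈ F n := hF.antitone hw (hHw hg)
    rw [hn, Subgroup.mem_bot] at this
    rw [this]
    exact one_mem _
  | succ m ihm =>
    intro w hw0 hw H'
    induction hc : Nat.card H' using Nat.strong_induction_on generalizing H' with
    | _ c ihc =>
      intro hwH hHw k g hg hk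
      by_cases hle : H' ≤ F (w + 1)
      · exact ihm (w + 1) w.succ_pos (by omega) H' ((hF.antitone (Nat.le_succ _)).trans hwH) hle
          k g hg hk
      · obtain ⟨x, hx, hxw⟩ := SetLike.not_le_iff_exists.1 hle
        -- The layer `F w / F (w + 1)` is elementary abelian because `w > 0` gives `p * w ≥ w + 1`
        -- and `w + w ≥ w + 1`.
        obtain ⟨θ, hθ, hθ0, hθx⟩ := exists_additive_form (p := p) (K := H') (B := F (w + 1))
          (fun a ha => hF.antitone (by nlinarith [hp.two_le]) (hF.pow_mem w a (hHw ha)))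
          (fun a ha b hb => hF.antitone (by omega) (hF.commutator_le w w
            (Subgroup.commutator_mem_commutator (hHw ha) (hHw hb)))) hwH hx hxw
        have hθ1 : θ 1 = 0 := hθ0 1 (one_mem _)
        let H : Subgroup P :=
          { carrier := {g | g ∈ H' ∧ θ g = 0}
            mul_mem' := fun {a b} ha hb =>
              ⟨mul_mem ha.1 hb.1, by rw [hθ a ha.1 b hb.1, ha.2, hb.2, add_zero]⟩
            one_mem' := ⟨one_mem _, hθ1⟩
            inv_mem' := fun {a} ha => ⟨inv_mem ha.1, by
              have := hθ a ha.1 _ (inv_mem ha.1)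
              rwa [mul_inv_cancel, hθ1, ha.2, zero_add, eq_comm] at this⟩ }
        have hH : ∀ g, g ∈ H ↔ g ∈ H' ∧ θ g = 0 := fun _ => Iff.rfl
        have hHH' : H ≤ H' := fun g hg => hg.1
        have hlt : H < H' := lt_of_le_of_ne hHH' (fun h => by
          have := (h ▸ hx : x ∈ H).2
          rw [hθx] at this
          exact one_ne_zero this)
        have hwH0 : F (w + 1) ≤ H := fun g hg => ⟨hwH hg, hθ0 g hg⟩
        rcases le_or_gt k w with hkw | hkw
        · exact hF.antitone hkw (hHw hg)
        · have hxi : ∀ i : ℕ, θ (x ^ i) = i := by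
            intro i
            induction i with
            | zero => simpa using hθ1
            | succ i ih => rw [pow_succ, hθ _ (pow_mem hx i) _ hx, ih, hθx]; simp
          have hinv : ∀ a ∈ H', θ a⁻¹ = - θ a := fun a ha => by
            have := hθ a⁻¹ (inv_mem ha) a ha
            rw [inv_mul_cancel, hθ1] at this
            exact eq_neg_of_add_eq_zero_left this.symm
          have hgθ : θ g = 0 := by
            have := (hk.extend_eq_zero hθ0 hF.antitone hθ).2 hkw
            rw [map_sub, ← map_one δ, monoidAlgebraExtend_of, monoidAlgebraExtend_of, hθ1,
              sub_zero] at this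
            exact this
          have hgH : g ∈ H := ⟨hg, hgθ⟩
          refine ihc _ ?_ H rfl hwH0 (hHH'.trans hHw) k g hgH ?_
          · rw [← hc]
            exact Set.ncard_lt_ncard (s := (H : Set P)) (t := (H' : Set P)) hlt (Set.toFinite _)
          -- Rewrite `g - 1` through powers of `x - 1` and elements over `H`, then project to `H`.
          -- The projection fixes `g` and `1` since `θ` vanishes on both.
          · have hmem := augSpan.augPow_le (H := H) hF (hHw hx) (fun h hh => ⟨mul_mem (mul_mem
              (inv_mem hx) hh.1) hx, by
                rw [hθ _ (mul_mem (inv_mem hx) hh.1) _ hx, hθ _ (inv_mem hx) _ hh.1,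
                  hinv x hx, hh.2]; ring⟩) hwH0 (hHH'.trans hHw) (fun g hg =>
                ⟨(θ g).val, (x ^ (θ g).val)⁻¹ * g, ⟨mul_mem (inv_mem (pow_mem hx _)) hg, by
                  rw [hθ _ (inv_mem (pow_mem hx _)) _ hg, hinv _ (pow_mem hx _), hxi,
                    ZMod.natCast_zmod_val, neg_add_cancel]⟩, by group⟩) hk
            have := augSpan.augPow_extend hF hθ hx (hHw hx) hθx hH hmem
            rw [map_sub, ← map_one δ, monoidAlgebraExtend_of, monoidAlgebraExtend_of, hθ1, hgθ] at this
            rwa [ZMod.val_zero, pow_zero, inv_one, one_mul, one_mul, map_one] at this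

end Step

end Jennings

/-! ### Formal properties of the Zassenhaus filtration -/

section ZassenhausProperties


variable (p : ℕ) [hp : Fact p.Prime] (G : Type u) [Group G] [TopologicalSpace G]
  [IsTopologicalGroup G]

lemma isClosed_zassenhaus (n : ℕ) : IsClosed (zassenhaus p G n : Set G) := by
  match n with
  | 0 => rw [zassenhaus]; exact isClosed_univ
  | 1 => rw [zassenhaus]; exact isClosed_univ
  | n + 2 => rw [zassenhaus]; exact Subgroup.isClosed_topologicalClosure _

lemma zassenhaus_one : zassenhaus p G 1 = ⊤ := by rw [zassenhaus]

lemma zassenhaus_zero : zassenhaus p G 0 = ⊤ := by rw [zassenhaus]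

variable {p G}

lemma pow_mem_zassenhaus {n : ℕ} {g : G} (hg : g ∈ zassenhaus p G ((n + 2) ⌈/⌉ p)) :
    g ^ p ∈ zassenhaus p G (n + 2) := by
  rw [zassenhaus]
  refine Subgroup.le_topologicalClosure _ (Subgroup.mem_sup_left ?_)
  exact Subgroup.subset_closure ⟨g, hg, rfl⟩

lemma commutator_zassenhaus_succ_le (i j : ℕ) :
    ⁅zassenhaus p G (i + 1), zassenhaus p G (j + 1)⁆ ≤ zassenhaus p G (i + j + 2) := by
  rw [zassenhaus.eq_3]
  refine le_trans ?_ ((le_sup_right).trans (Subgroup.le_topologicalClosure _))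
  refine le_trans ?_ (le_iSup _ (⟨i, by omega⟩ : Fin (i + j + 1)))
  have : i + j + 1 - i = j + 1 := by omega
  simp only [this]
  exact le_rfl

/-- The Zassenhaus filtration is contained in every restricted filtration by closed subgroups. -/
lemma zassenhaus_le_of_isRestrictedFiltration {F : ℕ → Subgroup G}
    (hF : IsRestrictedFiltration p F) (hc : ∀ k, IsClosed (F k : Set G)) (n : ℕ) :
    zassenhaus p G n ≤ F n := by
  induction n using Nat.strong_induction_on with
  | _ n ih =>
    match n, ih with
    | 0, _ => rw [hF.zero_eq_top]; exact le_top
    | 1, _ => rw [hF.one_eq_top]; exact le_top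
    | n + 2, ih =>
      rw [zassenhaus]
      refine Subgroup.topologicalClosure_minimal _ (sup_le ?_ (iSup_le fun i => ?_)) (hc _)
      · rw [Subgroup.closure_le]
        rintro _ ⟨g, hg, rfl⟩
        -- What is needed is `n + 2 ≤ p * ⌈(n + 2) / p⌉`.
        refine hF.antitone ?_ (hF.pow_mem _ g (ih _ (ceilDiv_prime_lt p n) hg))
        rw [mul_comm, ← smul_eq_mul]
        simpa [mul_comm] using le_smul_ceilDiv (β := ℕ) (b := n + 2) hp.out.pos
      · refine (Subgroup.commutator_mono (ih _ (by omega)) (ih _ (by omega))).trans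
          ((hF.commutator_le _ _).trans (hF.antitone ?_))
        omega

/-- Monotonicity is not built into the recursion. Generators of degree `n + 3` are compared with
those of degree `n + 2`: for powers the ceiling can only drop; in a commutator the first index is
lowered by one, and if that index is already `1`, normality suffices. -/
lemma zassenhaus_succ_le (n : ℕ) : zassenhaus p G (n + 1) ≤ zassenhaus p G n := by
  induction n using Nat.strong_induction_on with
  | _ n ih =>
    match n, ih with
    | 0, _ => rw [zassenhaus_zero]; exact le_top
    | 1, _ => rw [zassenhaus_one]; exact le_top
    | n + 2, ih =>
      rw [zassenhaus.eq_3 p G (n + 1)]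
      have hanti : ∀ m ≤ n + 2, ∀ l ≤ m, zassenhaus p G m ≤ zassenhaus p G l := by
        intro m hm l hl
        induction m, hl using Nat.le_induction with
        | base => exact le_rfl
        | succ m _ ihm => exact (ih m (by omega)).trans (ihm (by omega))
      refine Subgroup.topologicalClosure_minimal _ (sup_le ?_ (iSup_le fun i => ?_))
        (isClosed_zassenhaus p G _)
      · rw [Subgroup.closure_le]
        rintro _ ⟨g, hg, rfl⟩
        refine pow_mem_zassenhaus (hanti _ ?_ _ ?_ hg)
        · have := ceilDiv_prime_lt p (n + 1)
          omega
        · rw [Nat.ceilDiv_eq_add_pred_div, Nat.ceilDiv_eq_add_pred_div]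
          exact Nat.div_le_div_right (by omega)
      · obtain ⟨i, hi⟩ := i
        rcases i with _ | i
        · simp only [zero_add, Nat.sub_zero]
          exact Subgroup.commutator_le_right _ _
        · have h := commutator_zassenhaus_succ_le (p := p) (G := G) i (n - i)
          have e1 : i + (n - i) + 2 = n + 2 := by omega
          have e2 : n + 1 + 1 - (i + 1) = n - i + 1 := by omega
          rw [e1] at h
          simp only [e2]
          exact (Subgroup.commutator_mono (ih _ (by omega)) le_rfl).trans h

lemma antitone_zassenhaus : Antitone (zassenhaus p G) :=
  antitone_nat_of_succ_le zassenhaus_succ_le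

lemma isRestrictedFiltration_zassenhaus : IsRestrictedFiltration p (zassenhaus p G) where
  one_eq_top := zassenhaus_one p G
  antitone := antitone_zassenhaus
  commutator_le i j := by
    rcases i with _ | i
    · rw [zero_add]; exact Subgroup.commutator_le_right _ _
    · rcases j with _ | j
      · exact Subgroup.commutator_le_left _ _
      · have := commutator_zassenhaus_succ_le (p := p) (G := G) i j
        rwa [show i + 1 + (j + 1) = i + j + 2 by ring]
  pow_mem i g hg := by
    rcases i with _ | i
    · rw [mul_zero, zassenhaus_zero]; exact Subgroup.mem_top _
    · obtain ⟨m, hm⟩ : ∃ m, p * (i + 1) = m + 2 :=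
        Nat.exists_eq_add_of_le' (by nlinarith [hp.out.two_le])
      rw [hm]
      refine pow_mem_zassenhaus ?_
      rw [← hm, Nat.ceilDiv_eq_add_pred_div]
      have : (p * (i + 1) + p - 1) / p = i + 1 := by
        rw [Nat.add_sub_assoc hp.out.one_le, Nat.mul_add_div hp.out.pos,
          Nat.div_eq_of_lt (by have := hp.out.pos; omega), add_zero]
      rwa [this]

lemma IsRestrictedFiltration.comap {p : ℕ} {P Q : Type*} [Group P] [Group Q]
    {F : ℕ → Subgroup Q} (hF : IsRestrictedFiltration p F) (f : P →* Q) :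
    IsRestrictedFiltration p (fun k => (F k).comap f) where
  one_eq_top := by rw [hF.one_eq_top, Subgroup.comap_top]
  antitone _ _ h := Subgroup.comap_mono (hF.antitone h)
  commutator_le i j := by
    rw [Subgroup.commutator_le]
    intro a ha b hb
    rw [Subgroup.mem_comap, map_commutatorElement]
    exact hF.commutator_le i j (Subgroup.commutator_mem_commutator ha hb)
  pow_mem i g hg := by
    rw [Subgroup.mem_comap, map_pow]
    exact hF.pow_mem i _ hg

lemma IsRestrictedFiltration.map {p : ℕ} {P Q : Type*} [Group P] [Group Q]
    {F : ℕ → Subgroup P} (hF : IsRestrictedFiltration p F) {f : P →* Q}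
    (hf : Function.Surjective f) : IsRestrictedFiltration p (fun k => (F k).map f) where
  one_eq_top := by rw [hF.one_eq_top, Subgroup.map_top_of_surjective f hf]
  antitone _ _ h := Subgroup.map_mono (hF.antitone h)
  commutator_le i j := by
    rw [← Subgroup.map_commutator]
    exact Subgroup.map_mono (hF.commutator_le i j)
  pow_mem i g hg := by
    obtain ⟨a, ha, rfl⟩ := hg
    exact ⟨a ^ p, hF.pow_mem i a ha, map_pow _ _ _⟩

lemma zassenhaus_le_comap {H : Type v} [Group H] [TopologicalSpace H] [IsTopologicalGroup H]
    (f : G →ₜ* H) (n : ℕ) :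
    zassenhaus p G n ≤ (zassenhaus p H n).comap (f : G →* H) :=
  zassenhaus_le_of_isRestrictedFiltration
    (isRestrictedFiltration_zassenhaus.comap (f : G →* H))
    (fun k => (isClosed_zassenhaus p H k).preimage f.continuous_toFun) n

/-- Compactness makes the images of the terms closed, so they form a closed restricted filtration of
`H`, and minimality gives the inclusion opposite to functoriality. -/
lemma map_zassenhaus [CompactSpace G] {H : Type v} [Group H] [TopologicalSpace H]
    [IsTopologicalGroup H] [T2Space H] (f : G →ₜ* H) (hf : Function.Surjective f) (n : ℕ) :
    (zassenhaus p G n).map (f : G →* H) = zassenhaus p H n :=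
  le_antisymm (Subgroup.map_le_iff_le_comap.2 (zassenhaus_le_comap f n))
    (zassenhaus_le_of_isRestrictedFiltration (isRestrictedFiltration_zassenhaus.map hf)
      (fun k => ((isClosed_zassenhaus p G k).isCompact.image f.continuous_toFun).isClosed) n)

end ZassenhausProperties

/-! ### Unitriangular matrices -/

namespace Unitriangular


variable {n : ℕ} {R : Type u} [CommRing R]

/-- A unitriangular matrix as an element of `Unitriangular n R`. -/
noncomputable def ofMatrix (A : Matrix (Fin (n + 1)) (Fin (n + 1)) R) (h0 : ∀ i j, j < i → A i j = 0)
    (h1 : ∀ i, A i i = 1) : Unitriangular n R :=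
  ⟨((Matrix.isUnit_iff_isUnit_det A).2 (by
      rw [Matrix.det_of_isUpperTriangular (fun i j h => h0 i j h)]
      simp [h1])).unit, h0, h1⟩

@[simp] lemma val_ofMatrix (A : Matrix (Fin (n + 1)) (Fin (n + 1)) R) (h0) (h1) :
    val (ofMatrix A h0 h1) = A := rfl

/-- The matrices whose entries vanish below the `k`-th superdiagonal. -/
def superdiagonal (n : ℕ) (R : Type u) [CommRing R] (k : ℕ) :
    Submodule R (Matrix (Fin (n + 1)) (Fin (n + 1)) R) where
  carrier := {A | ∀ i j : Fin (n + 1), (j : ℕ) < i + k → A i j = 0}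
  zero_mem' _ _ _ := rfl
  add_mem' hA hB i j h := by rw [Matrix.add_apply, hA i j h, hB i j h, add_zero]
  smul_mem' c A hA i j h := by rw [Matrix.smul_apply, hA i j h, smul_zero]

lemma superdiagonal_mono {k l : ℕ} (h : l ≤ k) : superdiagonal n R k ≤ superdiagonal n R l :=
  fun _ hA i j hij => hA i j (by omega)

lemma mul_mem_superdiagonal {k l : ℕ} {A B : Matrix (Fin (n + 1)) (Fin (n + 1)) R}
    (hA : A ∈ superdiagonal n R k) (hB : B ∈ superdiagonal n R l) :
    A * B ∈ superdiagonal n R (k + l) := by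
  intro i j h
  rw [Matrix.mul_apply]
  refine Finset.sum_eq_zero fun m _ => ?_
  rcases lt_or_ge (m : ℕ) (i + k) with h1 | h1
  · rw [hA i m h1, zero_mul]
  · rw [hB m j (by omega), mul_zero]

lemma pow_mem_superdiagonal {k : ℕ} {A : Matrix (Fin (n + 1)) (Fin (n + 1)) R}
    (hA : A ∈ superdiagonal n R k) (m : ℕ) : A ^ m ∈ superdiagonal n R (m * k) := by
  induction m with
  | zero =>
    intro i j h
    rw [pow_zero]
    exact Matrix.one_apply_ne (by rintro rfl; omega)
  | succ m ih => rw [pow_succ, add_one_mul]; exact mul_mem_superdiagonal ih hA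

lemma val_mem_superdiagonal (M : Unitriangular n R) : val M ∈ superdiagonal n R 0 :=
  fun _ _ h => val_apply_of_lt M (Fin.lt_def.2 h)

lemma val_sub_one_mem (M : Unitriangular n R) : val M - 1 ∈ superdiagonal n R 1 := by
  intro i j h
  rcases (Nat.lt_succ_iff.1 h).lt_or_eq with h | h
  · rw [Matrix.sub_apply, val_apply_of_lt M (Fin.lt_def.2 h),
      Matrix.one_apply_ne (by rintro rfl; omega), sub_zero]
  · rw [show j = i from Fin.ext h, Matrix.sub_apply, val_apply_self, Matrix.one_apply_eq, sub_self]

/-- The subgroup of the matrices `I + A`, where `A` vanishes below the `k`-th superdiagonal. -/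
def level (n : ℕ) (R : Type u) [CommRing R] (k : ℕ) : Subgroup (Unitriangular n R) where
  carrier := {M | val M - 1 ∈ superdiagonal n R k}
  one_mem' := by
    change val (1 : Unitriangular n R) - 1 ∈ superdiagonal n R k
    rw [val_one, sub_self]; exact zero_mem _
  mul_mem' {M N} hM hN := by
    change val (M * N) - 1 ∈ superdiagonal n R k
    have : val (M * N) - 1 = (val M - 1) * val N + (val N - 1) := by
      rw [val_mul]; noncomm_ring
    rw [this]
    exact add_mem (mul_mem_superdiagonal hM (val_mem_superdiagonal N)) hN
  inv_mem' {M} hM := by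
    change val M⁻¹ - 1 ∈ superdiagonal n R k
    have : val M⁻¹ - 1 = -((val M - 1) * val M⁻¹) := by
      rw [sub_mul, one_mul, ← val_mul, mul_inv_cancel, val_one, neg_sub]
    rw [this]
    exact neg_mem (mul_mem_superdiagonal hM (val_mem_superdiagonal _))

lemma mem_level {k : ℕ} {M : Unitriangular n R} :
    M ∈ level n R k ↔ val M - 1 ∈ superdiagonal n R k := Iff.rfl

lemma level_eq_bot : level n R (n + 1) = ⊥ := by
  rw [eq_bot_iff]
  intro M hM
  refine Subgroup.mem_bot.2 (ext_val (sub_eq_zero.1 ?_))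
  ext i j
  exact hM i j (by omega)

lemma mem_corner_of_mem_level {M : Unitriangular n R} (hM : M ∈ level n R n) :
    M ∈ corner n R := by
  intro i j hij
  rw [← sub_eq_zero, ← Matrix.sub_apply]
  refine hM i j ?_
  by_contra! h
  exact hij ⟨Fin.ext (by rw [Fin.val_zero]; omega), Fin.ext (by rw [Fin.val_last]; omega)⟩

/-- `MN - NM = (M - 1)(N - 1) - (N - 1)(M - 1)` handles commutators, and `M ^ p - 1 = (M - 1) ^ p`
in characteristic `p` handles powers. -/
lemma isRestrictedFiltration_level (p : ℕ) [Fact p.Prime] [CharP R p] :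
    IsRestrictedFiltration p (level n R) where
  one_eq_top := top_le_iff.1 fun M _ => val_sub_one_mem M
  antitone _ _ h _ hM := superdiagonal_mono h hM
  commutator_le i j := by
    rw [Subgroup.commutator_le]
    intro M hM N hN
    have h : val ⁅M, N⁆ - 1
        = ((val M - 1) * (val N - 1) - (val N - 1) * (val M - 1)) * val (M⁻¹ * N⁻¹) := by
      have h1 : (val N * val M) * val (M⁻¹ * N⁻¹) = 1 := by
        rw [← val_mul, ← val_mul, show N * M * (M⁻¹ * N⁻¹) = 1 by group, val_one]
      calc _ = val M * val N * val (M⁻¹ * N⁻¹) - val N * val M * val (M⁻¹ * N⁻¹) := by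
            rw [h1, commutatorElement_def, ← val_mul, ← val_mul, ← mul_assoc]
        _ = _ := by noncomm_ring
    rw [mem_level, h]
    refine mul_mem_superdiagonal (k := i + j) (l := 0) (sub_mem (mul_mem_superdiagonal hM hN) ?_)
      (val_mem_superdiagonal _)
    exact add_comm j i ▸ mul_mem_superdiagonal hN hM
  pow_mem i M hM := by
    have h : val (M ^ p) = val M ^ p := by
      generalize p = m
      induction m with
      | zero => rfl
      | succ m ih => rw [pow_succ, val_mul, ih, pow_succ]
    have h' := sub_pow_char_of_commute p (Commute.one_right (val M))
    rw [one_pow] at h'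
    rw [mem_level, h, ← h']
    exact pow_mem_superdiagonal hM p

lemma map_mem_level {p : ℕ} [Fact p.Prime] [CharP R p] {G : Type v} [Group G] [TopologicalSpace G]
    [IsTopologicalGroup G] (ρ : G →ₜ* Unitriangular n R) {k : ℕ} {g : G}
    (hg : g ∈ zassenhaus p G k) : ρ g ∈ level n R k :=
  zassenhaus_le_of_isRestrictedFiltration
    ((isRestrictedFiltration_level (n := n) (R := R) p).comap (ρ : G →* Unitriangular n R))
    (fun k => (isClosed_discrete (level n R k : Set (Unitriangular n R))).preimage
      ρ.continuous_toFun) k hg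

lemma zassenhaus_le_homKernel {p : ℕ} [Fact p.Prime] [CharP R p] {G : Type v} [Group G]
    [TopologicalSpace G] [IsTopologicalGroup G] :
    zassenhaus p G (n + 1) ≤ homKernel (Unitriangular n R) G := by
  refine le_iInf fun ρ g hg => ?_
  have := map_mem_level ρ hg
  rwa [level_eq_bot] at this

/-- The matrix with upper-left block `A` and lower-right block `1`. -/
def extendMatrix (A : Matrix (Fin (n + 1)) (Fin (n + 1)) R) :
    Matrix (Fin (n + 2)) (Fin (n + 2)) R := fun i j =>
  Fin.lastCases (motive := fun _ => R) ((1 : Matrix (Fin (n + 2)) (Fin (n + 2)) R) i (Fin.last _))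
    (fun j => Fin.lastCases (motive := fun _ => R) 0 (fun i => A i j) i) j

@[simp] lemma extendMatrix_castSucc (A : Matrix (Fin (n + 1)) (Fin (n + 1)) R) (i j : Fin (n + 1)) :
    extendMatrix A i.castSucc j.castSucc = A i j := by simp [extendMatrix]

@[simp] lemma extendMatrix_last_castSucc (A : Matrix (Fin (n + 1)) (Fin (n + 1)) R)
    (j : Fin (n + 1)) : extendMatrix A (Fin.last _) j.castSucc = 0 := by simp [extendMatrix]

@[simp] lemma extendMatrix_castSucc_last (A : Matrix (Fin (n + 1)) (Fin (n + 1)) R)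
    (i : Fin (n + 1)) : extendMatrix A i.castSucc (Fin.last _) = 0 := by
  simp [extendMatrix, Fin.castSucc_ne_last]

@[simp] lemma extendMatrix_last_last (A : Matrix (Fin (n + 1)) (Fin (n + 1)) R) :
    extendMatrix A (Fin.last _) (Fin.last _) = 1 := by simp [extendMatrix]

/-- The embedding `U_n(R) → U_{n+1}(R)` as upper-left blocks. -/
noncomputable def castSucc : Unitriangular n R →* Unitriangular (n + 1) R :=
  MonoidHom.mk' (fun M => ofMatrix (extendMatrix (val M))
    (fun i j h => by
      induction j using Fin.lastCases with
      | last => exact absurd h (Fin.le_last i).not_gt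
      | cast j =>
        induction i using Fin.lastCases with
        | last => simp
        | cast i => simpa using val_apply_of_lt M (by simpa using h))
    (fun i => by
      induction i using Fin.lastCases with
      | last => simp
      | cast i => simpa using val_apply_self M i)) (by
  intro M N
  apply ext_val
  ext i j
  change extendMatrix (val M * val N) i j = (extendMatrix (val M) * extendMatrix (val N)) i j
  rw [Matrix.mul_apply, Fin.sum_univ_castSucc]
  induction j using Fin.lastCases with
  | last => induction i using Fin.lastCases <;> simp
  | cast j => induction i using Fin.lastCases <;> simp [Matrix.mul_apply])

lemma castSucc_injective : Function.Injective (castSucc (n := n) (R := R)) := by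
  intro M N h
  apply ext_val
  ext i j
  have := congrFun₂ (congrArg val h) i.castSucc j.castSucc
  simpa [castSucc] using this

lemma homKernel_succ_le {G : Type v} [Group G] [TopologicalSpace G] [IsTopologicalGroup G] :
    homKernel (Unitriangular (n + 1) R) G ≤ homKernel (Unitriangular n R) G := by
  refine le_iInf fun ρ g hg => ?_
  let ρ' : G →ₜ* Unitriangular (n + 1) R :=
    ⟨castSucc.comp (ρ : G →* Unitriangular n R),
      (continuous_of_discreteTopology (f := castSucc)).comp ρ.continuous_toFun⟩
  have h : ρ' g = 1 := (Subgroup.mem_iInf.1 hg ρ' :)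
  exact castSucc_injective (h.trans (map_one _).symm)

end Unitriangular

/-! ### Matrix representations attached to words -/

namespace Unitriangular

variable (n : ℕ) (R : Type w) [CommRing R] {X : Type v} [DecidableEq X] (v : List X)

/-- The matrix of the letter `x` attached to the word `v`: the sum of the elementary matrices
`E_{i,i+1}` over the positions `i` at which the letter `x` occurs in `v`. -/
def letterMatrix (x : X) : Matrix (Fin (n + 1)) (Fin (n + 1)) R :=
  fun i j => if (j : ℕ) = i + 1 ∧ v[(i : ℕ)]? = some x then 1 else 0

/-- The unitriangular matrix `I + E_x` attached to the letter `x` of the word `v`. -/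
noncomputable def letterUnit (x : X) : Unitriangular n R :=
  ofMatrix (1 + letterMatrix n R v x)
    (fun i j h => by
      rw [Matrix.add_apply, Matrix.one_apply_ne h.ne', letterMatrix, if_neg (by
        rw [Fin.lt_def] at h; omega), add_zero])
    (fun i => by
      rw [Matrix.add_apply, Matrix.one_apply_eq, letterMatrix, if_neg (by omega), add_zero])

variable {n R v}

lemma val_letterUnit (x : X) : val (letterUnit n R v x) = 1 + letterMatrix n R v x := rfl

lemma letterUnit_eq_one {x : X} (hx : x ∉ v) : letterUnit n R v x = 1 := by
  apply ext_val
  rw [val_letterUnit, val_one, add_eq_left]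
  ext i j
  rw [letterMatrix, if_neg, Matrix.zero_apply]
  exact fun h => hx (List.mem_of_getElem? h.2)

/-- Each letter advances the column by one and must match the letter of `v` at that position, so
only one path contributes to the product. -/
lemma prod_letterMatrix_apply (u : List X) (i j : Fin (n + 1)) :
    (u.map (letterMatrix n R v)).prod i j =
      if (j : ℕ) = i + u.length ∧ u <+: v.drop i then 1 else 0 := by
  induction u generalizing i with
  | nil =>
    rw [List.map_nil, List.prod_nil, Matrix.one_apply]
    simp [Fin.ext_iff, eq_comm]
  | cons x u ih =>
    rw [List.map_cons, List.prod_cons, Matrix.mul_apply]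
    have hpre : (x :: u <+: v.drop i) ↔ v[(i : ℕ)]? = some x ∧ u <+: v.drop (i + 1) := by
      rcases lt_or_ge (i : ℕ) v.length with h | h
      · rw [List.drop_eq_getElem_cons h, List.cons_prefix_cons, List.getElem?_eq_getElem h,
          Option.some_inj, eq_comm]
      · simp [List.drop_eq_nil_of_le h, List.getElem?_eq_none h]
    rcases lt_or_ge (i : ℕ) n with hi | hi
    · rw [Finset.sum_eq_single (⟨i + 1, by omega⟩ : Fin (n + 1))]
      · rw [ih, letterMatrix]
        simp only [true_and, hpre, List.length_cons, ← ite_and, mul_ite, mul_one, mul_zero]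
        refine if_congr ?_ rfl rfl
        constructor
        · rintro ⟨⟨h1, h2⟩, h3⟩
          exact ⟨by omega, h3, h2⟩
        · rintro ⟨h1, h3, h2⟩
          exact ⟨⟨by omega, h2⟩, h3⟩
      · intro k _ hk
        rw [letterMatrix, if_neg, zero_mul]
        exact fun h => hk (Fin.ext h.1)
      · simp
    · rw [if_neg (by rw [List.length_cons]; omega)]
      refine Finset.sum_eq_zero fun k _ => ?_
      rw [letterMatrix, if_neg (by omega), zero_mul]

lemma val_list_prod (L : List (Unitriangular n R)) : val L.prod = (L.map val).prod := by
  induction L with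
  | nil => rfl
  | cons x L ih => rw [List.prod_cons, val_mul, ih, List.map_cons, List.prod_cons]

/-- Evaluation of noncommutative polynomials at the letter matrices of a word. -/
noncomputable def wordEval (n : ℕ) (R : Type w) [CommRing R] (v : List X) :
    MonoidAlgebra R (FreeMonoid X) →ₐ[R] Matrix (Fin (n + 1)) (Fin (n + 1)) R :=
  MonoidAlgebra.lift R _ _ (FreeMonoid.lift (letterMatrix n R v))

/-- The entries of the letter matrices of a word `v` compute the coefficient at `v`. -/
lemma wordEval_apply (f : MonoidAlgebra R (FreeMonoid X)) (hv : v.length < n + 1) :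
    wordEval n R v f 0 ⟨v.length, hv⟩ = f.coeff (FreeMonoid.ofList v) := by
  classical
  induction f using MonoidAlgebra.induction_on with
  | of u =>
    rw [wordEval, MonoidAlgebra.lift_of, FreeMonoid.lift_apply, prod_letterMatrix_apply]
    simp only [Fin.val_zero, zero_add, List.drop_zero, MonoidAlgebra.of_apply]
    rw [MonoidAlgebra.coeff_single, Finsupp.single_apply]
    refine if_congr ?_ rfl rfl
    constructor
    · rintro ⟨h1, h2⟩
      exact FreeMonoid.toList.injective (h2.eq_of_length h1.symm)
    · rintro rfl
      exact ⟨rfl, List.prefix_refl _⟩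
  | add f g hf hg => rw [map_add, Matrix.add_apply, hf, hg]; rfl
  | smul c f hf => rw [map_smul, Matrix.smul_apply, hf]; rfl

end Unitriangular

/-! ### Free profinite groups -/

section Profinite

variable {S : Type u} [Group S] [TopologicalSpace S] [IsTopologicalGroup S] [CompactSpace S]

/-- An open normal subgroup separating a point from a closed subgroup of a profinite group. -/
lemma exists_open_normal_notMem_sup [TotallyDisconnectedSpace S] {C : Subgroup S}
    (hC : IsClosed (C : Set S)) {s : S} (hs : s ∉ C) :
    ∃ U : Subgroup S, U.Normal ∧ IsOpen (U : Set S) ∧ s ∉ C ⊔ U := by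
  -- `U` is chosen so that `s * u⁻¹ ∉ C` for all `u ∈ U`.
  obtain ⟨U, hU⟩ := ProfiniteGrp.exist_openNormalSubgroup_sub_open_nhds_of_one
    (U := (fun u => s * u⁻¹) ⁻¹' (C : Set S)ᶜ)
    (hC.isOpen_compl.preimage (by fun_prop)) (by simpa using hs)
  refine ⟨U.toSubgroup, U.isNormal', U.isOpen', fun h => ?_⟩
  have := U.isNormal'
  obtain ⟨c, hc, u, hu, rfl⟩ := (Subgroup.mem_sup_of_normal_right (s := C) (t := U.toSubgroup)).1 h
  exact hU hu (by simpa using hc)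

end Profinite

namespace IsFreeProfiniteOn

variable {X : Type v} {S : Type u} [Group S] [TopologicalSpace S] [IsTopologicalGroup S]
  [CompactSpace S] [T2Space S] [TotallyDisconnectedSpace S] {ι : X → S}

/-- The universal property for finite discrete groups. -/
lemma exists_lift (hS : IsFreeProfiniteOn ι) {U : Type} [Group U] [TopologicalSpace U]
    [DiscreteTopology U] [Finite U] (f : X → U) (hf : {x | f x ≠ 1}.Finite) :
    ∃ φ : S →ₜ* U, ∀ x, φ (ι x) = f x := by
  have hd : DiscreteTopology (ULift.{u} U) :=
    (Homeomorph.ulift (X := U)).isEmbedding.discreteTopology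
  obtain ⟨φ, hφ, -⟩ := hS.existsUnique_lift (ULift.{u} U) (fun x => ULift.up (f x)) (by
    rw [nhds_discrete, tendsto_pure]
    refine mem_of_superset hf.compl_mem_cofinite fun x hx => ?_
    have : f x = 1 := by simpa using hx
    exact congrArg ULift.up this)
  exact ⟨⟨(MulEquiv.ulift (α := U)).toMonoidHom.comp (φ : S →* ULift.{u} U),
    (continuous_uliftDown (X := U)).comp φ.continuous_toFun⟩, fun x => congrArg ULift.down (hφ x)⟩

/-- The basis extends to a homomorphism from `S` into this closed subgroup; composed with the
inclusion it must be the identity, by uniqueness of extensions. -/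
lemma topologicalClosure_closure_range (hS : IsFreeProfiniteOn ι) :
    (Subgroup.closure (Set.range ι)).topologicalClosure = ⊤ := by
  set C := (Subgroup.closure (Set.range ι)).topologicalClosure with hC
  have hc : IsClosed (C : Set S) := Subgroup.isClosed_topologicalClosure _
  have hι : ∀ x, ι x ∈ C := fun x =>
    Subgroup.le_topologicalClosure _ (Subgroup.subset_closure ⟨x, rfl⟩)
  have : CompactSpace C := isCompact_iff_compactSpace.1 hc.isCompact
  obtain ⟨φ, hφ, -⟩ := hS.existsUnique_lift C (fun x => ⟨ι x, hι x⟩)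
    (tendsto_subtype_rng.2 hS.tendsto_one)
  let φ' : S →ₜ* S := ⟨C.subtype.comp (φ : S →* C), continuous_subtype_val.comp φ.continuous_toFun⟩
  have h := (hS.existsUnique_lift S ι hS.tendsto_one).unique (y₁ := φ')
    (y₂ := ContinuousMonoidHom.id S) (fun x => congrArg Subtype.val (hφ x)) (fun _ => rfl)
  rw [eq_top_iff]
  intro s _
  have hs : (φ s : S) = s := congrArg (fun ψ : S →ₜ* S => ψ s) h
  exact hs ▸ (φ s).2

/-- Modulo an open normal subgroup, every element is a product of basis elements. -/
lemma exists_list_prod (hS : IsFreeProfiniteOn ι) {V : Subgroup S} [V.Normal]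
    (hV : IsOpen (V : Set S)) (s : S) : ∃ L : List X, s⁻¹ * (L.map ι).prod ∈ V := by
  have : Finite (S ⧸ V) := V.quotient_finite_of_isOpen hV
  have hs : s ∈ closure (Subgroup.closure (Set.range ι) : Set S) := by
    rw [← Subgroup.topologicalClosure_coe, hS.topologicalClosure_closure_range]
    exact Set.mem_univ _
  obtain ⟨γ, hγV, hγ⟩ := mem_closure_iff.1 hs ((fun g => s⁻¹ * g) ⁻¹' (V : Set S))
    (hV.preimage (by fun_prop)) (by simp)
  -- In a finite group a submonoid is a subgroup, so no inverses of basis elements are needed.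
  have hγ' : (γ : S ⧸ V) ∈ Submonoid.closure (Set.range fun x => (ι x : S ⧸ V)) := by
    have h := Subgroup.mem_map_of_mem (QuotientGroup.mk' V) hγ
    rw [MonoidHom.map_closure, ← Set.range_comp, ← Subgroup.mem_toSubmonoid,
      Subgroup.closure_toSubmonoid_of_finite] at h
    exact h
  have key : ∀ y ∈ Submonoid.closure (Set.range fun x => (ι x : S ⧸ V)),
      ∃ L : List X, y = ((L.map ι).prod : S) := by
    intro y hy
    induction hy using Submonoid.closure_induction with
    | mem y hy => obtain ⟨x, rfl⟩ := hy; exact ⟨[x], by simp⟩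
    | one => exact ⟨[], by simp⟩
    | mul y z _ _ h1 h2 =>
      obtain ⟨L, rfl⟩ := h1
      obtain ⟨M, rfl⟩ := h2
      exact ⟨L ++ M, by simp⟩
  obtain ⟨L, hL⟩ := key _ hγ'
  refine ⟨L, ?_⟩
  rw [← QuotientGroup.eq, ← hL, QuotientGroup.eq]
  exact hγV

instance {n : ℕ} {R : Type w} [CommRing R] [Finite R] : Finite (Unitriangular n R) :=
  Finite.of_injective Unitriangular.val fun _ _ h => Unitriangular.ext_val h

/-- For a free profinite group, the Zassenhaus filtration consists of the intersections of the
kernels of the homomorphisms to the groups of unitriangular matrices. -/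
theorem homKernel_unitriangular {p : ℕ} [Fact p.Prime] (hS : IsFreeProfiniteOn ι) (n : ℕ) :
    homKernel (Unitriangular n (ZMod p)) S = zassenhaus p S (n + 1) := by
  classical
  refine le_antisymm (fun s hs => ?_) Unitriangular.zassenhaus_le_homKernel
  by_contra hsC
  obtain ⟨U, hUn, hU, hsU⟩ := exists_open_normal_notMem_sup (isClosed_zassenhaus p S (n + 1)) hsC
  set B : Subgroup S := zassenhaus p S (n + 1) ⊔ U with hB
  have hBo : IsOpen (B : Set S) := Subgroup.isOpen_mono le_sup_right hU
  have : Finite (S ⧸ B) := B.quotient_finite_of_isOpen hBo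
  let F : ℕ → Subgroup (S ⧸ B) := fun k => (zassenhaus p S k).map (QuotientGroup.mk' B)
  have hF : IsRestrictedFiltration p F :=
    isRestrictedFiltration_zassenhaus.map (QuotientGroup.mk'_surjective B)
  have hFn : F (n + 1) = ⊥ := by
    rw [Subgroup.map_eq_bot_iff, QuotientGroup.ker_mk']
    exact le_sup_left
  let g : S ⧸ B := s
  -- Jennings' theorem, started at weight `1` with the whole group, would give `g ∈ F (n + 1) = ⊥`,
  -- contradicting the choice of `B`.
  suffices h : AugPow p F ⊤ (n + 1) (MonoidAlgebra.of (ZMod p) (S ⧸ B) g - 1) by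
    have := AugPow.mem_of_sub_one hF hFn (n + 1) 1 one_pos (by omega) ⊤ le_top
      hF.one_eq_top.symm.le (n + 1) g (Subgroup.mem_top g) h
    rw [hFn, Subgroup.mem_bot] at this
    exact hsU ((QuotientGroup.eq_one_iff s).1 this)
  let X₀ : Set X := {x | ι x ∉ B}
  have hX₀ : X₀.Finite := by
    have := hS.tendsto_one (hBo.mem_nhds B.one_mem)
    exact mem_cofinite.1 this
  have : Finite X₀ := hX₀
  have hρ : ∀ v : List X, ∃ φ : S →ₜ* Unitriangular n (ZMod p),
      ∀ x, φ (ι x) = Unitriangular.letterUnit n (ZMod p) v x := fun v =>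
    hS.exists_lift _ (v.toFinset.finite_toSet.subset fun x hx => by
      by_contra hxv
      exact hx (Unitriangular.letterUnit_eq_one (by simpa using hxv)))
  choose ρ hρ using hρ
  let W : Set (List X₀) := {v | v.length ≤ n}
  have hW : W.Finite := List.finite_length_le X₀ n
  have : Finite W := hW
  -- Only finitely many words matter: length at most `n`, in the finitely many letters that survive
  -- modulo `B`. Hence `V` is open.
  let V : Subgroup S := B ⊓ ⨅ v : W, (ρ (v.1.map Subtype.val) : S →* Unitriangular n (ZMod p)).ker
  have hVo : IsOpen (V : Set S) := by
    rw [Subgroup.coe_inf, Subgroup.coe_iInf]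
    refine hBo.inter (isOpen_iInter_of_finite fun v => ?_)
    exact (isOpen_discrete {1}).preimage (ρ (v.1.map Subtype.val)).continuous_toFun
  have : V.Normal := by
    have : (⨅ v : W, (ρ (v.1.map Subtype.val) : S →* Unitriangular n (ZMod p)).ker).Normal :=
      Subgroup.normal_iInf_normal fun _ => inferInstance
    infer_instance
  obtain ⟨L, hL⟩ := hS.exists_list_prod hVo s
  let δ := MonoidAlgebra.of (ZMod p) (S ⧸ B)
  -- The Magnus expansion of the product of basis elements approximating `s`.
  let T : MonoidAlgebra (ZMod p) (FreeMonoid X) :=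
    (L.map fun x => 1 + MonoidAlgebra.of (ZMod p) (FreeMonoid X) (FreeMonoid.of x)).prod
  let ev : MonoidAlgebra (ZMod p) (FreeMonoid X) →ₐ[ZMod p] MonoidAlgebra (ZMod p) (S ⧸ B) :=
    MonoidAlgebra.lift (ZMod p) _ _ (FreeMonoid.lift fun x => δ (ι x : S ⧸ B) - 1)
  have hevT : ev (T - 1) = δ g - 1 := by
    have hg : g = ((L.map ι).prod : S) := QuotientGroup.eq.2 hL.1
    have h1 : ev T = δ g := by
      rw [hg, map_list_prod, List.map_map]
      have h2 : (((L.map ι).prod : S) : S ⧸ B) = (L.map fun x => (ι x : S ⧸ B)).prod := by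
        rw [← QuotientGroup.mk'_apply, map_list_prod, List.map_map]; rfl
      rw [h2, map_list_prod, List.map_map]
      congr 1
      refine List.map_congr_left fun x _ => ?_
      simp only [Function.comp_apply, ev, map_add, map_one, MonoidAlgebra.lift_of,
        FreeMonoid.lift_eval_of]
      abel
    rw [map_sub, map_one, h1]
  rw [← hevT]
  have hexp : ev (T - 1) = (T - 1).coeff.sum fun u c => c • FreeMonoid.lift
      (fun x => δ (ι x : S ⧸ B) - 1) u := MonoidAlgebra.lift_apply _ _
  have hlen : ∀ u : List X, AugPow p F ⊤ u.length ((u.map fun x => δ (ι x : S ⧸ B) - 1).prod) := by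
    intro u
    induction u with
    | nil => exact .one
    | cons x u ih =>
      rw [List.map_cons, List.prod_cons]
      exact .cons (v := 1) (Subgroup.mem_top _) (hF.one_eq_top ▸ Subgroup.mem_top _) ih
        (by rw [List.length_cons, add_comm])
  rw [hexp, Finsupp.sum]
  refine Finset.sum_induction _ (AugPow p F ⊤ (n + 1)) (fun _ _ => .add) (.zero _) fun u _ => ?_
  rw [FreeMonoid.lift_apply]
  -- Long words have degree at least `n + 1`; short words in the letters of `X₀` have coefficient
  -- `0`; a word with a letter outside `X₀` evaluates to `0`.
  rcases Nat.lt_or_ge n u.toList.length with hu | hu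
  · exact .smul _ ((hlen u.toList).mono hu)
  · by_cases hX : ∀ x ∈ u.toList, x ∈ X₀
    · have hcoeff : (T - 1).coeff u = 0 := by
        have h := Unitriangular.wordEval_apply (n := n) (v := u.toList) (T - 1) (by omega)
        rw [FreeMonoid.ofList_toList] at h
        rw [← h]
        lift u.toList to List X₀ using hX with v hv
        have h1 : ρ (v.map Subtype.val) (L.map ι).prod = 1 := by
          have h2 := Subgroup.mem_iInf.1 hL.2 ⟨v, by simpa [W] using hu⟩
          have h3 : ρ (v.map Subtype.val) s = 1 := Subgroup.mem_iInf.1 hs (ρ (v.map Subtype.val))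
          have h4 : ρ (v.map Subtype.val) (s⁻¹ * (L.map ι).prod) = 1 := h2
          rwa [map_mul, map_inv, h3, inv_one, one_mul] at h4
        have h5 : Unitriangular.wordEval n (ZMod p) (v.map Subtype.val) T = 1 := by
          rw [← Unitriangular.val_one, ← h1, map_list_prod, map_list_prod, Unitriangular.val_list_prod,
            List.map_map, List.map_map, List.map_map]
          congr 1
          refine List.map_congr_left fun x _ => ?_
          simp only [Function.comp_apply, hρ, Unitriangular.val_letterUnit, Unitriangular.wordEval,
            map_add, map_one, MonoidAlgebra.lift_of, FreeMonoid.lift_eval_of]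
        rw [map_sub, map_one, h5, sub_self, Matrix.zero_apply]
      rw [hcoeff, zero_smul]
      exact .zero _
    · push Not at hX
      obtain ⟨x, hx, hxX⟩ := hX
      have hxB : (ι x : S ⧸ B) = 1 := (QuotientGroup.eq_one_iff _).2 (not_not.1 hxX)
      rw [List.prod_eq_zero (List.mem_map.2 ⟨x, hx, by rw [hxB, map_one, sub_self]⟩), smul_zero]
      exact .zero _

end IsFreeProfiniteOn

/-! ### Transgression -/

section Transgression

variable {Γ : Type u} [Group Γ] [TopologicalSpace Γ] [IsTopologicalGroup Γ]
  {Q : Type v} [Group Q] [TopologicalSpace Q] [IsTopologicalGroup Q]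
  {A : Type w} [AddCommGroup A] [TopologicalSpace A] [IsTopologicalAddGroup A]

/-- The class `c ∈ H²(Q, A)` is the transgression of the restriction of `φ` to `ker q`: the inflation
of some cocycle of class `c` is the coboundary of `φ`, and `φ 1 = 0`. -/
structure IsTransgression (q : Γ →ₜ* Q) (c : ContH2 Q A) (φ : C(Γ, A)) : Prop where
  map_one : φ 1 = 0
  exists_cocycle : ∃ f : cocycles2 Q A, (QuotientAddGroup.mk f : ContH2 Q A) = c ∧
    ∀ a b, f.1 (q a, q b) = φ b - φ (a * b) + φ a

lemma cocycles2_apply_one_left {f : C(Q × Q, A)} (hf : f ∈ cocycles2 Q A) (y : Q) :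
    f (1, y) = f (1, 1) := by
  have h := hf 1 1 y
  rw [one_mul, one_mul, sub_self, zero_add, sub_eq_zero] at h
  exact h

namespace IsTransgression

variable {q : Γ →ₜ* Q} {c d : ContH2 Q A} {φ ψ : C(Γ, A)}

lemma zero : IsTransgression q (0 : ContH2 Q A) 0 :=
  ⟨rfl, 0, rfl, fun _ _ => by simp⟩

lemma add (h : IsTransgression q c φ) (h' : IsTransgression q d ψ) :
    IsTransgression q (c + d) (φ + ψ) := by
  obtain ⟨h1, f, rfl, hf⟩ := h
  obtain ⟨h1', f', rfl, hf'⟩ := h'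
  refine ⟨by simp [h1, h1'], f + f', rfl, fun a b => ?_⟩
  rw [AddSubgroup.coe_add, ContinuousMap.add_apply, hf, hf']
  simp only [ContinuousMap.add_apply]
  abel

lemma neg (h : IsTransgression q c φ) : IsTransgression q (-c) (-φ) := by
  obtain ⟨h1, f, rfl, hf⟩ := h
  refine ⟨by simp [h1], -f, rfl, fun a b => ?_⟩
  rw [AddSubgroup.coe_neg, ContinuousMap.neg_apply, hf]
  simp only [ContinuousMap.neg_apply]
  abel

lemma sub (h : IsTransgression q c φ) (h' : IsTransgression q d ψ) :
    IsTransgression q (c - d) (φ - ψ) := by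
  rw [sub_eq_add_neg, sub_eq_add_neg]
  exact h.add h'.neg

/-- A cocycle satisfies `f (1, y) = f (1, 1)`, which is `0` here because `φ 1 = 0`. So `φ` is a
character on `ker q`, and it also controls translation by `ker q`. -/
lemma map_mul_left (h : IsTransgression q c φ) {k : Γ} (hk : q k = 1) (b : Γ) :
    φ (k * b) = φ k + φ b := by
  obtain ⟨h1, f, -, hf⟩ := h
  have e1 := hf k b
  have e2 := hf 1 1
  rw [hk, cocycles2_apply_one_left f.2] at e1
  rw [_root_.map_one, mul_one, h1, sub_self, zero_add] at e2
  rw [e2, eq_comm, sub_add_eq_add_sub, sub_eq_zero] at e1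
  rw [← e1, add_comm]

lemma pullback_eq_zero (h : IsTransgression q c φ) : ContH2.pullback q c = 0 := by
  obtain ⟨-, f, rfl, hf⟩ := h
  exact (QuotientAddGroup.eq_zero_iff _).2 ⟨φ, hf⟩

lemma exists_of_pullback_eq_zero (h : ContH2.pullback q c = 0) :
    ∃ φ : C(Γ, A), IsTransgression q c φ := by
  induction c using QuotientAddGroup.induction_on with | H f =>
  obtain ⟨φ, hφ⟩ := (QuotientAddGroup.eq_zero_iff (cocycles2Pullback q f)).1 h
  -- Shifting `φ` by a constant to make it vanish at `1` changes its coboundary by that constant;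
  -- the coboundary of `e` corrects `f` accordingly.
  let e : C(Q, A) := ContinuousMap.const Q (-φ 1)
  let δe : cocycles2 Q A := ⟨⟨fun x => e x.2 - e (x.1 * x.2) + e x.1, by fun_prop⟩,
    coboundaries2_le_cocycles2 Q A ⟨e, fun _ _ => rfl⟩⟩
  refine ⟨φ + ContinuousMap.const Γ (-φ 1), by simp, f + δe, ?_, fun a b => ?_⟩
  · rw [eq_comm, QuotientAddGroup.eq, neg_add_cancel_left]
    exact ⟨e, fun _ _ => rfl⟩
  · have : f.1 (q a, q b) = φ b - φ (a * b) + φ a := hφ a b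
    rw [AddSubgroup.coe_add, ContinuousMap.add_apply, this]
    simp only [δe, e, ContinuousMap.coe_mk, ContinuousMap.const_apply, ContinuousMap.add_apply]
    abel

/-- The transgression is injective if all homomorphisms from `Γ` are trivial on the kernel. -/
lemma apply_eq_zero (h : IsTransgression q (0 : ContH2 Q A) φ)
    (hq : ∀ χ : C(Γ, A), (∀ a b, χ (a * b) = χ a + χ b) → ∀ k, q k = 1 → χ k = 0) {k : Γ}
    (hk : q k = 1) : φ k = 0 := by
  obtain ⟨h1, f, hf0, hf⟩ := h
  obtain ⟨ψ, hψ⟩ := (QuotientAddGroup.eq_zero_iff _).1 hf0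
  have hψ' : ∀ a b, f.1 (q a, q b) = ψ (q b) - ψ (q (a * b)) + ψ (q a) := fun a b => by
    rw [map_mul]; exact hψ _ _
  have h2 : ψ 1 = 0 := by
    have e := hψ' 1 1
    rw [hf] at e
    simpa [h1] using e.symm
  -- Two cochains with the same coboundary differ by a homomorphism.
  have := hq (φ - ψ.comp (q : C(Γ, Q))) (fun a b => by
    have e := (hf a b).symm.trans (hψ' a b)
    change φ (a * b) - ψ (q (a * b)) = (φ a - ψ (q a)) + (φ b - ψ (q b))
    rw [← sub_eq_zero] at e ⊢
    rw [← neg_eq_zero, ← e]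
    abel) k hk
  have h3 : φ k - ψ (q k) = 0 := this
  rwa [hk, h2, sub_zero] at h3

lemma congr_of_eq (h : IsTransgression q c φ) (h' : IsTransgression q c ψ)
    (hq : ∀ χ : C(Γ, A), (∀ a b, χ (a * b) = χ a + χ b) → ∀ k, q k = 1 → χ k = 0) {k : Γ}
    (hk : q k = 1) : φ k = ψ k := by
  have := h.sub h'
  rw [sub_self] at this
  exact sub_eq_zero.1 (this.apply_eq_zero hq hk)

lemma comp (h : IsTransgression q c φ) {Γ' : Type*} [Group Γ'] [TopologicalSpace Γ']
    [IsTopologicalGroup Γ'] (π : Γ' →ₜ* Γ) :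
    IsTransgression (q.comp π) c (φ.comp (π : C(Γ', Γ))) := by
  obtain ⟨h1, f, rfl, hf⟩ := h
  refine ⟨by simp [h1], f, rfl, fun a b => ?_⟩
  have := hf (π a) (π b)
  rw [← map_mul] at this
  exact this

/-- The cocycle already lives on `Q`, so only `φ` has to descend; it is constant on the fibres of
`π` by `map_mul_left`. -/
lemma exists_descend {Γ' : Type*} [Group Γ'] [TopologicalSpace Γ'] [IsTopologicalGroup Γ']
    {π : Γ' →ₜ* Γ} (hπ : IsQuotientMap π) {φ : C(Γ', A)} (h : IsTransgression (q.comp π) c φ)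
    (hφ : ∀ k, π k = 1 → φ k = 0) :
    ∃ ψ : C(Γ, A), (∀ a, ψ (π a) = φ a) ∧ IsTransgression q c ψ := by
  have hker : ∀ a b, π a = π b → φ a = φ b := fun a b hab => by
    have h1 : π (a * b⁻¹) = 1 := by rw [map_mul, map_inv, hab, mul_inv_cancel]
    have h2 : q.comp π (a * b⁻¹) = 1 := by
      change q (π (a * b⁻¹)) = 1
      rw [h1, _root_.map_one]
    have h3 := h.map_mul_left h2 b
    rwa [inv_mul_cancel_right, hφ _ h1, zero_add] at h3
  have hπ' : IsQuotientMap (π : C(Γ', Γ)) := hπ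
  let ψ : C(Γ, A) := hπ'.lift φ hker
  have hψ : ∀ a, ψ (π a) = φ a := fun a => congrArg (fun g : C(Γ', A) => g a) (hπ'.lift_comp φ hker)
  obtain ⟨h1, f, rfl, hf⟩ := h
  refine ⟨ψ, hψ, by rw [← h1, ← hψ, _root_.map_one π], f, rfl, fun a b => ?_⟩
  obtain ⟨a, rfl⟩ := hπ.surjective a
  obtain ⟨b, rfl⟩ := hπ.surjective b
  rw [← map_mul, hψ, hψ, hψ]
  exact hf a b

/-- The transgression is well defined. -/
lemma eq_zero (hq : IsQuotientMap q) (h : IsTransgression q c φ) (hφ : ∀ k, q k = 1 → φ k = 0) :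
    c = 0 := by
  -- Descending all the way to `Q` turns `φ` into a cochain there that bounds the cocycle.
  obtain ⟨ψ, -, hψ⟩ := exists_descend (q := ContinuousMonoidHom.id Q) (π := q) hq h hφ
  obtain ⟨-, f, rfl, hf⟩ := hψ
  exact (QuotientAddGroup.eq_zero_iff _).2 ⟨ψ, hf⟩

lemma eq_of_eqOn (hq : IsQuotientMap q) (h : IsTransgression q c φ) (h' : IsTransgression q d ψ)
    (hφ : ∀ k, q k = 1 → φ k = ψ k) : c = d :=
  sub_eq_zero.1 ((h.sub h').eq_zero hq fun k hk => sub_eq_zero.2 (hφ k hk))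

/-- One may change the cocycle. -/
lemma exists_of_rep {f : cocycles2 Q A} (hf1 : f.1 (1, 1) = 0)
    (h : IsTransgression q (QuotientAddGroup.mk f) φ) :
    ∃ ψ : C(Γ, A), (∀ a b, f.1 (q a, q b) = ψ b - ψ (a * b) + ψ a) ∧
      ∀ k, q k = 1 → ψ k = φ k := by
  obtain ⟨h1, f', hf', hf⟩ := h
  obtain ⟨e, he⟩ := QuotientAddGroup.eq.1 hf'
  have he' : ∀ a b, f.1 (q a, q b) = f'.1 (q a, q b) + (e (q b) - e (q (a * b)) + e (q a)) :=
    fun a b => by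
      have : -f'.1 (q a, q b) + f.1 (q a, q b) = e (q b) - e (q a * q b) + e (q a) := he _ _
      rw [map_mul, ← this]; abel
  -- The normalisation of `f` at `(1, 1)` is what keeps the character on `ker q` unchanged.
  have he1 : e 1 = 0 := by
    have := he' 1 1
    rw [hf] at this
    simpa [h1, hf1] using this.symm
  refine ⟨φ + e.comp (q : C(Γ, Q)), fun a b => ?_, fun k hk => ?_⟩
  · rw [he', hf]
    change _ = (φ b + e (q b)) - (φ (a * b) + e (q (a * b))) + (φ a + e (q a))
    abel
  · change φ k + e (q k) = φ k
    rw [hk, he1, add_zero]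

end IsTransgression

end Transgression

/-! ### Lifting homomorphisms to unitriangular groups -/

namespace Unitriangular

variable {n : ℕ} {R : Type w} [CommRing R]

lemma eq_of_mem_corner {z y : Unitriangular n R} (hz : z ∈ corner n R) (hy : y ∈ corner n R)
    (h : cornerCoord z = cornerCoord y) : z = y := by
  apply ext_val
  ext i j
  by_cases hij : i = 0 ∧ j = Fin.last n
  · rw [hij.1, hij.2]
    simpa [cornerCoord] using h
  · rw [hz i j hij, hy i j hij]

/-- The matrix `I + r E_{1,n+1}`. -/
noncomputable def cornerElem [NeZero n] (r : R) : Unitriangular n R :=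
  ofMatrix (1 + Matrix.single 0 (Fin.last n) r)
    (fun i j h => by
      rw [Matrix.add_apply, Matrix.one_apply_ne h.ne', zero_add, Matrix.single_apply_of_ne]
      rintro ⟨rfl, rfl⟩
      exact (Fin.zero_le _).not_gt h)
    (fun i => by
      rw [Matrix.add_apply, Matrix.one_apply_eq, Matrix.single_apply_of_ne, add_zero]
      rintro ⟨rfl, h⟩
      exact NeZero.ne n (by simpa using (congrArg Fin.val h)))

lemma cornerElem_mem [NeZero n] (r : R) : cornerElem r ∈ corner n R := by
  intro i j hij
  rw [cornerElem, val_ofMatrix, Matrix.add_apply, Matrix.single_apply_of_ne, add_zero]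
  exact fun h => hij ⟨h.1.symm, h.2.symm⟩

lemma cornerCoord_cornerElem [NeZero n] (r : R) : cornerCoord (cornerElem r : Unitriangular n R) = r := by
  simp [cornerCoord, cornerElem]

lemma cornerCoord_eq_zero {z : Unitriangular n R} (hz : z ∈ corner n R) (h : cornerCoord z = 0) :
    z = 1 := eq_of_mem_corner hz (one_mem _) (h.trans cornerCoord_one.symm)

/-- With `s 1 = 1` the factor set vanishes at `(1, 1)`, and on `ker q` corner coordinates can be
read off without correction. -/
lemma exists_section (n : ℕ) (R : Type w) [CommRing R] : ∃ s : Bar n R → Unitriangular n R,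
    (∀ x, (s x : Bar n R) = x) ∧ s 1 = 1 := by
  classical
  refine ⟨fun x => if x = 1 then 1 else Quotient.out x, fun x => ?_, if_pos rfl⟩
  dsimp only
  split_ifs with h
  · exact h.symm
  · exact QuotientGroup.out_eq' x

variable [TopologicalSpace R] [IsTopologicalAddGroup R]
  {Γ : Type u} [Group Γ] [TopologicalSpace Γ] [IsTopologicalGroup Γ]
  {Q : Type v} [Group Q] [TopologicalSpace Q] [IsTopologicalGroup Q] {q : Γ →ₜ* Q}
  {ρ' : Q →ₜ* Bar n R}

lemma pullback_classifyingElement {s : Bar n R → Unitriangular n R}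
    (hs : ∀ x, (s x : Bar n R) = x) :
    ContH2.pullback ρ' (classifyingElement n R) =
      QuotientAddGroup.mk (cocycles2Pullback ρ' (factorSet s hs)) := by
  rw [classifyingElement_eq n R s hs]
  rfl

/-- A homomorphism to `Ū_n` whose class becomes trivial lifts to `U_n`. -/
lemma exists_lift_of_isTransgression [NeZero n] [DiscreteTopology R] {φ : C(Γ, R)}
    (h : IsTransgression q (ContH2.pullback ρ' (classifyingElement n R)) φ) :
    ∃ ρ : Γ →ₜ* Unitriangular n R, (∀ g, (ρ g : Bar n R) = ρ' (q g)) ∧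
      ∀ k, q k = 1 → φ k = -cornerCoord (ρ k) := by
  obtain ⟨s, hs, hs1⟩ := exists_section n R
  rw [pullback_classifyingElement hs] at h
  have hf : ∀ x y, (cocycles2Pullback ρ' (factorSet s hs)).1 (x, y) =
    cornerCoord (s (ρ' x) * s (ρ' y) * (s (ρ' x * ρ' y))⁻¹) := fun _ _ => rfl
  obtain ⟨ψ, hψ, hψφ⟩ := h.exists_of_rep (by rw [hf]; simp [hs1, cornerCoord_one])
  -- The failure of `s` to be multiplicative is the coboundary of `ψ`; the twist by `-ψ` in the
  -- central corner cancels it.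
  refine ⟨⟨MonoidHom.mk' (fun g => cornerElem (-ψ g) * s (ρ' (q g))) fun a b => ?_, ?_⟩,
    fun g => ?_, fun k hk => ?_⟩
  · set x := ρ' (q a)
    set y := ρ' (q b)
    have hxy : ρ' (q (a * b)) = x * y := by rw [map_mul, map_mul]
    have h1 : cornerElem (-ψ (a * b)) = cornerElem (-ψ a) * cornerElem (-ψ b) *
        (s x * s y * (s (x * y))⁻¹) := by
      refine eq_of_mem_corner (cornerElem_mem _) (mul_mem (mul_mem (cornerElem_mem _)
        (cornerElem_mem _)) (factorSet_mem hs x y)) ?_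
      rw [cornerCoord_mul (mul_mem (cornerElem_mem _) (cornerElem_mem _)) (factorSet_mem hs x y),
        cornerCoord_mul (cornerElem_mem _) (cornerElem_mem _), cornerCoord_cornerElem,
        cornerCoord_cornerElem, cornerCoord_cornerElem, ← hf, hψ]
      abel
    rw [hxy, h1]
    calc _ = cornerElem (-ψ a) * (cornerElem (-ψ b) * s x) * s y := by group
      _ = _ := by rw [corner_comm (cornerElem_mem (-ψ b)) (s x)]; group
  · exact (continuous_of_discreteTopology
      (f := fun x : R × Bar n R => (cornerElem (-x.1) * s x.2 : Unitriangular n R))).comp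
      (ψ.continuous.prodMk (ρ'.continuous_toFun.comp q.continuous_toFun))
  · change ((cornerElem (-ψ g) * s (ρ' (q g)) : Unitriangular n R) : Bar n R) = _
    rw [QuotientGroup.mk_mul, hs, (QuotientGroup.eq_one_iff _).2 (cornerElem_mem _), one_mul]
  · change φ k = -cornerCoord (cornerElem (-ψ k) * s (ρ' (q k)))
    rw [hk, map_one, hs1, mul_one, cornerCoord_cornerElem, neg_neg, hψφ k hk]

/-- A lift to `U_n` of a homomorphism to `Ū_n` trivializes its class. -/
lemma exists_isTransgression_of_lift {ρ : Γ →ₜ* Unitriangular n R}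
    (hρ : ∀ g, (ρ g : Bar n R) = ρ' (q g)) :
    ∃ φ : C(Γ, R), IsTransgression q (ContH2.pullback ρ' (classifyingElement n R)) φ ∧
      ∀ k, q k = 1 → φ k = -cornerCoord (ρ k) := by
  obtain ⟨s, hs, hs1⟩ := exists_section n R
  have hmem : ∀ g, ρ g * (s (ρ' (q g)))⁻¹ ∈ corner n R := fun g => by
    rw [← QuotientGroup.eq_one_iff, QuotientGroup.mk_mul, QuotientGroup.mk_inv, hs, hρ,
      mul_inv_cancel]
  -- The central discrepancy between the lift and the section, with a minus sign, bounds the factor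
  -- set.
  refine ⟨⟨fun g => -cornerCoord (ρ g * (s (ρ' (q g)))⁻¹), ?_⟩, ⟨?_, _,
    (pullback_classifyingElement hs).symm, fun a b => ?_⟩, fun k hk => ?_⟩
  · exact (continuous_of_discreteTopology
      (f := fun x : Unitriangular n R × Bar n R => -cornerCoord (x.1 * (s x.2)⁻¹))).comp
      (ρ.continuous_toFun.prodMk (ρ'.continuous_toFun.comp q.continuous_toFun))
  · simp [hs1, cornerCoord_one]
  · change cornerCoord (s (ρ' (q a)) * s (ρ' (q b)) * (s (ρ' (q a) * ρ' (q b)))⁻¹) =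
      -cornerCoord (ρ b * (s (ρ' (q b)))⁻¹) - -cornerCoord (ρ (a * b) * (s (ρ' (q (a * b))))⁻¹)
        + -cornerCoord (ρ a * (s (ρ' (q a)))⁻¹)
    have ha := hmem a
    have hb := hmem b
    have hab := hmem (a * b)
    rw [map_mul, map_mul, map_mul] at hab
    rw [map_mul, map_mul, map_mul]
    set x := ρ' (q a)
    set y := ρ' (q b)
    have h1 : ρ a * (s x)⁻¹ * (ρ b * (s y)⁻¹) * (s x * s y * (s (x * y))⁻¹)
        = ρ a * ρ b * (s (x * y))⁻¹ := by
      calc _ = ρ a * (s x)⁻¹ * ((ρ b * (s y)⁻¹) * s x) * s y * (s (x * y))⁻¹ := by group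
        _ = _ := by rw [corner_comm hb]; group
    rw [← h1, cornerCoord_mul (mul_mem ha hb) (factorSet_mem hs x y), cornerCoord_mul ha hb]
    abel
  · change -cornerCoord (ρ k * (s (ρ' (q k)))⁻¹) = _
    rw [hk, map_one, hs1, inv_one, mul_one]

/-- A homomorphism to `U_n` which maps the kernel of `q` to the corner induces a homomorphism to
`Ū_n`. -/
lemma exists_bar (hq : IsQuotientMap q) (ρ : Γ →ₜ* Unitriangular n R)
    (hρ : ∀ k, q k = 1 → ρ k ∈ corner n R) :
    ∃ ρ' : Q →ₜ* Bar n R, ∀ g, (ρ g : Bar n R) = ρ' (q g) := by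
  let σ : Γ →* Bar n R := (QuotientGroup.mk' (corner n R)).comp (ρ : Γ →* Unitriangular n R)
  have hσ : (q : Γ →* Q).ker ≤ σ.ker := fun k hk =>
    (QuotientGroup.eq_one_iff (N := corner n R) (ρ k)).2 (hρ k hk)
  let τ : Q →* Bar n R := (q : Γ →* Q).liftOfSurjective hq.surjective ⟨σ, hσ⟩
  have hτ : ∀ g, σ g = τ (q g) := fun g =>
    ((q : Γ →* Q).liftOfRightInverse_comp_apply _ _ ⟨σ, hσ⟩ g).symm
  refine ⟨⟨τ, hq.continuous_iff.2 ?_⟩, hτ⟩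
  have : (τ ∘ q) = σ := funext fun g => (hτ g).symm
  change Continuous (τ ∘ q)
  rw [this]
  exact (continuous_of_discreteTopology (f := QuotientGroup.mk' (corner n R))).comp
    ρ.continuous_toFun

lemma superdiagonal_entry_mul (M N : Unitriangular n R) (i : Fin n) :
    val (M * N) i.castSucc i.succ = val M i.castSucc i.succ + val N i.castSucc i.succ := by
  have h0 := mul_mem_superdiagonal (val_sub_one_mem M) (val_sub_one_mem N) i.castSucc i.succ
    (by simp)
  have h1 : val (M * N) = (val M - 1) * (val N - 1) + val M + val N - 1 := by
    rw [val_mul]; noncomm_ring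
  rw [h1, Matrix.sub_apply, Matrix.add_apply, Matrix.add_apply, h0,
    Matrix.one_apply_ne i.castSucc_lt_succ.ne]
  ring

/-- The `(i, i+1)` entry as a homomorphism on `Ū_n(R)`, where `n ≥ 2`. -/
def barEntry (hn : 2 ≤ n) (i : Fin n) : Bar n R →* Multiplicative R :=
  QuotientGroup.lift (corner n R)
    (MonoidHom.mk' (fun M => Multiplicative.ofAdd (val M i.castSucc i.succ))
      fun M N => congrArg Multiplicative.ofAdd (superdiagonal_entry_mul M N i))
    fun M hM => congrArg Multiplicative.ofAdd (by
      have := hM i.castSucc i.succ (fun h => by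
        have h1 := congrArg Fin.val h.1
        have h2 := congrArg Fin.val h.2
        simp only [Fin.val_castSucc, Fin.val_succ, Fin.val_zero, Fin.val_last] at h1 h2
        omega)
      rwa [Matrix.one_apply_ne i.castSucc_lt_succ.ne] at this)

end Unitriangular

/-- The characters `φᵢ` impose no condition when they may vary: they are taken to be the entries of
`ρ`. -/
lemma pullback_mem_masseyElements {n p : ℕ} (hn : 2 ≤ n) {Q : Type v} [Group Q]
    [TopologicalSpace Q] [IsTopologicalGroup Q] (ρ : Q →ₜ* Unitriangular.Bar n (ZMod p)) :
    ContH2.pullback ρ (Unitriangular.classifyingElement n (ZMod p)) ∈ masseyElements n p Q := by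
  refine Set.mem_iUnion.2 ⟨fun i => ⟨(Unitriangular.barEntry hn i).comp
    (ρ : Q →* Unitriangular.Bar n (ZMod p)), (continuous_of_discreteTopology
      (f := Unitriangular.barEntry hn i)).comp ρ.continuous_toFun⟩, ρ, fun g M hM i => ?_, rfl⟩
  change _ = (Unitriangular.barEntry hn i (ρ g)).toAdd
  rw [← hM]
  rfl

lemma exists_pullback_of_mem_masseyElements {n p : ℕ} {Q : Type v} [Group Q]
    [TopologicalSpace Q] [IsTopologicalGroup Q] {c : ContH2 Q (ZMod p)}
    (hc : c ∈ masseyElements n p Q) : ∃ ρ : Q →ₜ* Unitriangular.Bar n (ZMod p),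
      c = ContH2.pullback ρ (Unitriangular.classifyingElement n (ZMod p)) := by
  obtain ⟨φ, ρ, -, h⟩ := Set.mem_iUnion.1 hc
  exact ⟨ρ, h⟩

/-! ### Duality for additive characters -/

section CharacterDuality

variable {p : ℕ} [Fact p.Prime] {Γ : Type u} [Group Γ]

/-- If the common kernel of finitely many characters of `K` is contained in the kernel of `χ`, then
`χ` is a linear combination of these characters. -/
lemma exists_mem_eqOn_of_finset (D : AddSubgroup (Γ → ZMod p)) (s : Finset (Γ → ZMod p))
    (hs : ∀ ψ ∈ s, ψ ∈ D) (χ : Γ → ZMod p) :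
    ∀ K : Subgroup Γ, (∀ ψ ∈ D, ∀ a ∈ K, ∀ b ∈ K, ψ (a * b) = ψ a + ψ b) →
      (∀ a ∈ K, ∀ b ∈ K, χ (a * b) = χ a + χ b) →
      (∀ k ∈ K, (∀ ψ ∈ s, ψ k = 0) → χ k = 0) → ∃ ψ ∈ D, ∀ k ∈ K, χ k = ψ k := by
  classical
  induction s using Finset.induction_on with
  | empty =>
    intro K _ _ h
    exact ⟨0, zero_mem _, fun k hk => h k hk (by simp)⟩
  | insert ψ₀ s _ ih =>
    intro K hD hχ h
    have hD₀ := hs ψ₀ (Finset.mem_insert_self _ _)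
    have hψ₀ := hD ψ₀ hD₀
    have hone : ∀ θ : Γ → ZMod p, (∀ a ∈ K, ∀ b ∈ K, θ (a * b) = θ a + θ b) → θ 1 = 0 :=
      fun θ hθ => by simpa using hθ 1 K.one_mem 1 K.one_mem
    have hinv : ∀ θ : Γ → ZMod p, (∀ a ∈ K, ∀ b ∈ K, θ (a * b) = θ a + θ b) →
        ∀ a ∈ K, θ a⁻¹ = -θ a := fun θ hθ a ha => by
      have h2 := hθ a⁻¹ (inv_mem ha) a ha
      rw [inv_mul_cancel, hone θ hθ] at h2
      exact eq_neg_of_add_eq_zero_left h2.symm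
    have hpow : ∀ θ : Γ → ZMod p, (∀ a ∈ K, ∀ b ∈ K, θ (a * b) = θ a + θ b) →
        ∀ a ∈ K, ∀ e : ℕ, θ (a ^ e) = e * θ a := fun θ hθ a ha e => by
      induction e with
      | zero => simpa using hone θ hθ
      | succ e ihe => rw [pow_succ, hθ _ (pow_mem ha e) _ ha, ihe]; push_cast; ring
    let L : Subgroup Γ :=
      { carrier := {g | g ∈ K ∧ ψ₀ g = 0}
        mul_mem' := fun {a b} ha hb =>
          ⟨mul_mem ha.1 hb.1, by rw [hψ₀ a ha.1 b hb.1, ha.2, hb.2, add_zero]⟩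
        one_mem' := ⟨one_mem _, hone ψ₀ hψ₀⟩
        inv_mem' := fun {a} ha => ⟨inv_mem ha.1, by rw [hinv ψ₀ hψ₀ a ha.1, ha.2, neg_zero]⟩ }
    obtain ⟨ψ, hψD, hψ⟩ := ih (fun ψ hψ => hs ψ (Finset.mem_insert_of_mem hψ)) L
      (fun ψ hψ a ha b hb => hD ψ hψ a ha.1 b hb.1) (fun a ha b hb => hχ a ha.1 b hb.1)
      (fun k hk hk' => h k hk.1 fun θ hθ => by
        rcases Finset.mem_insert.1 hθ with rfl | hθ
        · exact hk.2
        · exact hk' θ hθ)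
    by_cases h0 : ∃ l ∈ K, ψ₀ l ≠ 0
    · obtain ⟨l, hl, hl0⟩ := h0
      -- `c` makes `χ` and `ψ + c • ψ₀` agree at `l`. Since `D` is only an additive subgroup, the
      -- scalar acts through its natural representative.
      let c : ZMod p := (χ l - ψ l) / ψ₀ l
      refine ⟨ψ + c.val • ψ₀, add_mem hψD (nsmul_mem hD₀ _), fun k hk => ?_⟩
      -- Multiplying `k` by `l ^ (-e)` moves it into `L`, where `χ = ψ` is known.
      set e : ℕ := (ψ₀ k / ψ₀ l).val with he
      have hee : (e : ZMod p) = ψ₀ k / ψ₀ l := ZMod.natCast_zmod_val _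
      have hle := inv_mem (pow_mem hl e)
      have hmem : (l ^ e)⁻¹ * k ∈ L := ⟨mul_mem hle hk, by
        rw [hψ₀ _ hle _ hk, hinv ψ₀ hψ₀ _ (pow_mem hl e), hpow ψ₀ hψ₀ l hl, hee]
        field_simp
        ring⟩
      have key := hψ _ hmem
      rw [hχ _ hle _ hk, hinv χ hχ _ (pow_mem hl e), hpow χ hχ l hl,
        hD ψ hψD _ hle _ hk, hinv ψ (hD ψ hψD) _ (pow_mem hl e), hpow ψ (hD ψ hψD) l hl] at key
      have hc : c * ψ₀ k = e * (χ l - ψ l) := by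
        rw [hee]; simp only [c]; field_simp
      rw [Pi.add_apply, Pi.smul_apply, nsmul_eq_mul, ZMod.natCast_zmod_val, hc]
      linear_combination key
    · push Not at h0
      exact ⟨ψ, hψD, fun k hk => hψ k ⟨hk, h0 k hk⟩⟩

/-- The version of `exists_mem_eqOn_of_finset` for continuous characters of a compact group and
arbitrary families. -/
lemma exists_mem_eqOn [TopologicalSpace Γ] [CompactSpace Γ] {K : Subgroup Γ}
    (hK : IsClosed (K : Set Γ)) (D : AddSubgroup (Γ → ZMod p))
    (hD : ∀ ψ ∈ D, ∀ a ∈ K, ∀ b ∈ K, ψ (a * b) = ψ a + ψ b) (Ψ : Set (Γ → ZMod p))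
    (hΨ : ∀ ψ ∈ Ψ, Continuous ψ ∧ ψ ∈ D) {χ : Γ → ZMod p} (hχc : ContinuousOn χ K)
    (hχ : ∀ a ∈ K, ∀ b ∈ K, χ (a * b) = χ a + χ b)
    (h : ∀ k ∈ K, (∀ ψ ∈ Ψ, ψ k = 0) → χ k = 0) : ∃ ψ ∈ D, ∀ k ∈ K, χ k = ψ k := by
  classical
  -- The part of `K` where `χ ≠ 0` is compact and misses the common kernel of `Ψ`, hence already
  -- that of a finite subfamily.
  obtain ⟨t, ht⟩ := (hχc.preimage_isClosed_of_isClosed hK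
    (isClosed_discrete {0}ᶜ)).isCompact.elim_finite_subfamily_closed
    (fun ψ : Ψ => ψ.1 ⁻¹' {0}) (fun ψ => (isClosed_discrete {0}).preimage (hΨ ψ ψ.2).1) (by
      rw [Set.eq_empty_iff_forall_notMem]
      rintro k ⟨⟨hk, hk0⟩, hk'⟩
      exact hk0 (h k hk fun ψ hψ => Set.mem_iInter.1 hk' ⟨ψ, hψ⟩))
  refine exists_mem_eqOn_of_finset D (t.image Subtype.val) (fun ψ hψ => ?_) χ K hD hχ
    fun k hk hk' => ?_
  · obtain ⟨ψ, -, rfl⟩ := Finset.mem_image.1 hψ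
    exact (hΨ ψ ψ.2).2
  · by_contra hk0
    have : k ∈ (∅ : Set Γ) := ht ▸ ⟨⟨hk, hk0⟩, Set.mem_iInter₂.2 fun ψ hψ =>
      hk' ψ (Finset.mem_image_of_mem _ hψ)⟩
    exact this

end CharacterDuality

/-! ### Massey products and the kernel of inflation -/

section MasseyTransgression

variable {p n : ℕ} [Fact p.Prime]
  {Γ : Type u} [Group Γ] [TopologicalSpace Γ] [IsTopologicalGroup Γ]
  {Q : Type v} [Group Q] [TopologicalSpace Q] [IsTopologicalGroup Q] {q : Γ →ₜ* Q}

/-- Continuous homomorphisms to `ℤ/p` are trivial on the Zassenhaus filtration from degree `2` on. -/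
lemma additive_eq_zero_of_mem_zassenhaus (hn : 2 ≤ n) (χ : C(Γ, ZMod p))
    (hχ : ∀ a b, χ (a * b) = χ a + χ b) {k : Γ} (hk : k ∈ zassenhaus p Γ n) : χ k = 0 := by
  let f : Γ →* Multiplicative (ZMod p) := MonoidHom.mk' (fun g => Multiplicative.ofAdd (χ g))
    fun a b => congrArg Multiplicative.ofAdd (hχ a b)
  -- The kernel of a character, placed in all degrees from `2` on, is a closed restricted
  -- filtration; minimality applies.
  let F : ℕ → Subgroup Γ := fun k => if k ≤ 1 then ⊤ else f.ker
  have hF : ∀ k, f.ker ≤ F k := fun k => by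
    by_cases h : k ≤ 1
    · simp [F, h]
    · simp [F, h]
  have hFr : IsRestrictedFiltration p F :=
    { one_eq_top := if_pos le_rfl
      antitone := fun i j hij => by
        by_cases h : i ≤ 1
        · simp [F, h]
        · simp [F, h, show ¬ j ≤ 1 by omega]
      commutator_le := fun i j => Subgroup.commutator_le.2 fun a _ b _ => hF _ (by
        rw [MonoidHom.mem_ker, map_commutatorElement, commutatorElement_eq_one_iff_mul_comm,
          mul_comm])
      pow_mem := fun i g _ => hF _ (by
        rw [MonoidHom.mem_ker, map_pow]
        change Multiplicative.ofAdd (p • χ g) = 1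
        rw [nsmul_eq_mul, CharP.cast_eq_zero, zero_mul, ofAdd_zero]) }
  have hker : (f.ker : Set Γ) = χ ⁻¹' {0} := rfl
  have hmem := zassenhaus_le_of_isRestrictedFiltration hFr (fun k => by
    by_cases h : k ≤ 1
    · simp [F, h]
    · simp only [F, if_neg h, hker]
      exact (isClosed_discrete {0}).preimage χ.continuous) n hk
  simp only [F, if_neg (show ¬ n ≤ 1 by omega)] at hmem
  exact hmem

/-- Every homomorphism to `U_n` gives rise to an element of an `n`-fold Massey product. -/
lemma exists_massey_of_hom (hn : 2 ≤ n) (hq : IsQuotientMap q)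
    (hker : ∀ k, q k = 1 → k ∈ zassenhaus p Γ n) (ρ : Γ →ₜ* Unitriangular n (ZMod p)) :
    ∃ c ∈ masseyElements n p Q, ∃ φ : C(Γ, ZMod p), IsTransgression q c φ ∧
      ∀ k, q k = 1 → φ k = -Unitriangular.cornerCoord (ρ k) := by
  obtain ⟨ρ', hbar⟩ := Unitriangular.exists_bar hq ρ fun k hk =>
    Unitriangular.mem_corner_of_mem_level (Unitriangular.map_mem_level ρ (hker k hk))
  exact ⟨_, pullback_mem_masseyElements hn ρ', Unitriangular.exists_isTransgression_of_lift hbar⟩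

/-- An element of an `n`-fold Massey product with trivial inflation comes from a homomorphism to
`U_n`. -/
lemma exists_hom_of_massey (hn : 2 ≤ n) {c : ContH2 Q (ZMod p)} (hc : c ∈ masseyElements n p Q)
    (h0 : ContH2.pullback q c = 0) :
    ∃ (ρ : Γ →ₜ* Unitriangular n (ZMod p)) (φ : C(Γ, ZMod p)), IsTransgression q c φ ∧
      ∀ k, q k = 1 → φ k = -Unitriangular.cornerCoord (ρ k) := by
  have : NeZero n := ⟨by omega⟩
  obtain ⟨ρ', rfl⟩ := exists_pullback_of_mem_masseyElements hc
  obtain ⟨φ, hφ⟩ := IsTransgression.exists_of_pullback_eq_zero h0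
  obtain ⟨ρ, -, hρ⟩ := Unitriangular.exists_lift_of_isTransgression hφ
  exact ⟨ρ, φ, hφ, hρ⟩

/-- Sums of elements of Massey products with trivial inflation are transgressions of characters which
are trivial on the intersection of the kernels of the homomorphisms to `U_n`. -/
lemma exists_isTransgression_of_mem_closure (hn : 2 ≤ n) {c : ContH2 Q (ZMod p)}
    (hc : c ∈ AddSubgroup.closure {x ∈ masseyElements n p Q | ContH2.pullback q x = 0}) :
    ∃ φ : C(Γ, ZMod p), IsTransgression q c φ ∧
      ∀ k ∈ homKernel (Unitriangular n (ZMod p)) Γ, q k = 1 → φ k = 0 := by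
  induction hc using AddSubgroup.closure_induction with
  | mem c hc =>
    obtain ⟨ρ, φ, hφ, hρ⟩ := exists_hom_of_massey hn hc.1 hc.2
    refine ⟨φ, hφ, fun k hk hk1 => ?_⟩
    have : ρ k = 1 := Subgroup.mem_iInf.1 hk ρ
    rw [hρ k hk1, this, Unitriangular.cornerCoord_one, neg_zero]
  | zero => exact ⟨0, .zero, fun _ _ _ => rfl⟩
  | add c d _ _ h1 h2 =>
    obtain ⟨φ, hφ, hφ0⟩ := h1
    obtain ⟨ψ, hψ, hψ0⟩ := h2
    exact ⟨φ + ψ, hφ.add hψ, fun k hk hk1 => by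
      rw [ContinuousMap.add_apply, hφ0 k hk hk1, hψ0 k hk hk1, add_zero]⟩
  | neg c _ h1 =>
    obtain ⟨φ, hφ, hφ0⟩ := h1
    exact ⟨-φ, hφ.neg, fun k hk hk1 => by
      rw [ContinuousMap.neg_apply, hφ0 k hk hk1, neg_zero]⟩

/-- Conversely, a character which is trivial on the intersection of the kernels of the homomorphisms
to `U_n` transgresses to a sum of elements of Massey products. -/
lemma exists_mem_closure_isTransgression [CompactSpace Γ] (hn : 2 ≤ n) (hq : IsQuotientMap q)
    (hker : ∀ k, q k = 1 ↔ k ∈ zassenhaus p Γ n) {χ : Γ → ZMod p}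
    (hχc : ContinuousOn χ (zassenhaus p Γ n))
    (hχ : ∀ a ∈ zassenhaus p Γ n, ∀ b ∈ zassenhaus p Γ n, χ (a * b) = χ a + χ b)
    (hχ0 : ∀ k ∈ zassenhaus p Γ n, k ∈ homKernel (Unitriangular n (ZMod p)) Γ → χ k = 0) :
    ∃ c ∈ AddSubgroup.closure {x ∈ masseyElements n p Q | ContH2.pullback q x = 0},
      ∃ φ : C(Γ, ZMod p), IsTransgression q c φ ∧ ∀ k ∈ zassenhaus p Γ n, χ k = φ k := by
  -- Duality is applied to `D` and the cochains of all `ρ : Γ → U_n`. On `Γ_n` the latter are minus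
  -- corner coordinates, and `ρ` maps `Γ_n` to the corner, so their common zeros in `Γ_n` are killed
  -- by every `ρ`.
  let D : AddSubgroup (Γ → ZMod p) :=
    { carrier := {ψ | ∃ c ∈ AddSubgroup.closure {x ∈ masseyElements n p Q | ContH2.pullback q x = 0},
        ∃ φ : C(Γ, ZMod p), IsTransgression q c φ ∧ ∀ k ∈ zassenhaus p Γ n, ψ k = φ k}
      zero_mem' := ⟨0, zero_mem _, 0, .zero, fun _ _ => rfl⟩
      add_mem' := by
        rintro ψ ψ' ⟨c, hc, φ, hφ, hψ⟩ ⟨c', hc', φ', hφ', hψ'⟩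
        exact ⟨c + c', add_mem hc hc', φ + φ', hφ.add hφ', fun k hk => by
          rw [Pi.add_apply, hψ k hk, hψ' k hk, ContinuousMap.add_apply]⟩
      neg_mem' := by
        rintro ψ ⟨c, hc, φ, hφ, hψ⟩
        exact ⟨-c, neg_mem hc, -φ, hφ.neg, fun k hk => by
          rw [Pi.neg_apply, hψ k hk, ContinuousMap.neg_apply]⟩ }
  choose c hc φ hφ hφρ using exists_massey_of_hom (p := p) hn hq fun k => (hker k).1
  obtain ⟨ψ, ⟨d, hd, θ, hθ, hψθ⟩, hψ⟩ := exists_mem_eqOn (isClosed_zassenhaus p Γ n) D (by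
    rintro ψ ⟨c, -, φ, hφ, hψ⟩ a ha b hb
    rw [hψ _ (mul_mem ha hb), hψ a ha, hψ b hb, hφ.map_mul_left ((hker a).2 ha)])
    (Set.range fun ρ => (φ ρ : Γ → ZMod p)) (by
      rintro _ ⟨ρ, rfl⟩
      exact ⟨(φ ρ).continuous, c ρ, AddSubgroup.subset_closure ⟨hc ρ, (hφ ρ).pullback_eq_zero⟩, φ ρ,
        hφ ρ, fun _ _ => rfl⟩) hχc hχ (fun k hk h => hχ0 k hk (Subgroup.mem_iInf.2 fun ρ => by
      have h1 : φ ρ k = 0 := h _ ⟨ρ, rfl⟩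
      rw [hφρ ρ k ((hker k).2 hk), neg_eq_zero] at h1
      exact Unitriangular.cornerCoord_eq_zero (Unitriangular.mem_corner_of_mem_level
        (Unitriangular.map_mem_level ρ hk)) h1))
  exact ⟨d, hd, θ, hθ, fun k hk => (hψ k hk).trans (hψθ k hk)⟩

/-- Homomorphisms from a free profinite group to `Ū_n` lift to `U_n`, so that the inflations of
Massey products vanish. -/
lemma IsFreeProfiniteOn.pullback_massey_eq_zero {X : Type w} {S : Type u} [Group S]
    [TopologicalSpace S] [IsTopologicalGroup S] [CompactSpace S] [T2Space S]
    [TotallyDisconnectedSpace S] {ι : X → S} (hS : IsFreeProfiniteOn ι) (q : S →ₜ* Q)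
    {c : ContH2 Q (ZMod p)} (hc : c ∈ masseyElements n p Q) : ContH2.pullback q c = 0 := by
  obtain ⟨ρ', rfl⟩ := exists_pullback_of_mem_masseyElements hc
  obtain ⟨s, hs, hs1⟩ := Unitriangular.exists_section n (ZMod p)
  -- Convergence of the basis to `1`, together with `s 1 = 1`, leaves only finitely many nontrivial
  -- values to prescribe.
  have hopen : IsOpen {g : S | ρ' (q g) = 1} :=
    (isOpen_discrete {1}).preimage (ρ'.continuous_toFun.comp q.continuous_toFun)
  have hfin : {x | ρ' (q (ι x)) ≠ 1}.Finite :=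
    mem_cofinite.1 (hS.tendsto_one (hopen.mem_nhds (by simp)))
  obtain ⟨ρ, hρ⟩ := hS.exists_lift (fun x => s (ρ' (q (ι x)))) (hfin.subset fun x hx h => hx (by
    rw [h, hs1]))
  have hlift : ∀ g, (ρ g : Unitriangular.Bar n (ZMod p)) = ρ' (q g) := by
    let ρ₁ : S →* Unitriangular.Bar n (ZMod p) :=
      (QuotientGroup.mk' _).comp (ρ : S →* Unitriangular n (ZMod p))
    let ρ₂ : S →* Unitriangular.Bar n (ZMod p) := (ρ'.comp q : S →ₜ* _)
    have hcl : IsClosed (ρ₁.eqLocus ρ₂ : Set S) := isClosed_eq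
      ((continuous_of_discreteTopology (f := QuotientGroup.mk' _)).comp ρ.continuous_toFun)
      (ρ'.comp q).continuous_toFun
    have hle : (Subgroup.closure (Set.range ι)).topologicalClosure ≤ ρ₁.eqLocus ρ₂ := by
      refine Subgroup.topologicalClosure_minimal _ ((Subgroup.closure_le _).2 ?_) hcl
      rintro _ ⟨x, rfl⟩
      change (ρ (ι x) : Unitriangular.Bar n (ZMod p)) = ρ' (q (ι x))
      rw [hρ, hs]
    rw [hS.topologicalClosure_closure_range] at hle
    exact fun g => hle (Subgroup.mem_top g)
  obtain ⟨φ, hφ, -⟩ := Unitriangular.exists_isTransgression_of_lift hlift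
  exact hφ.pullback_eq_zero

/-- A character of `K` is continuous if it is trivial on `K ∩ U` for an open subgroup `U`. -/
lemma continuousOn_of_additive {K U : Subgroup Γ} (hU : IsOpen (U : Set Γ)) {χ : Γ → ZMod p}
    (hχ : ∀ a ∈ K, ∀ b ∈ K, χ (a * b) = χ a + χ b) (h0 : ∀ k ∈ K, k ∈ U → χ k = 0) :
    ContinuousOn χ K := by
  intro k hk
  refine (continuousWithinAt_const (b := χ k)).congr_of_eventuallyEq ?_ rfl
  have hnhds : (fun g => k⁻¹ * g) ⁻¹' (U : Set Γ) ∈ 𝓝 k :=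
    (hU.preimage (by fun_prop)).mem_nhds (by simp)
  filter_upwards [self_mem_nhdsWithin, nhdsWithin_le_nhds hnhds] with g hg hgU
  have hkg := mul_mem (inv_mem hk) hg
  have h := hχ k hk _ hkg
  rwa [mul_inv_cancel_left, h0 _ hkg hgU, add_zero] at h

/-- Homomorphisms to `U_n` factor modulo subgroups of the Zassenhaus filtration. -/
lemma mem_homKernel_of_mk_mem {N : Subgroup Γ} [N.Normal] (hN : N ≤ zassenhaus p Γ (n + 1)) {g : Γ}
    (hg : (g : Γ ⧸ N) ∈ homKernel (Unitriangular n (ZMod p)) (Γ ⧸ N)) :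
    g ∈ homKernel (Unitriangular n (ZMod p)) Γ := by
  refine Subgroup.mem_iInf.2 fun ρ => ?_
  have hρ : ∀ k ∈ N, (ρ : Γ →* Unitriangular n (ZMod p)) k = 1 := fun k hk =>
    Subgroup.mem_iInf.1 (Unitriangular.zassenhaus_le_homKernel (hN hk)) ρ
  exact Subgroup.mem_iInf.1 hg ⟨QuotientGroup.lift N (ρ : Γ →* Unitriangular n (ZMod p)) hρ,
    continuous_quot_lift _ ρ.continuous_toFun⟩

end MasseyTransgression

/-! ### The main theorem -/

theorem theorem9p3 {p : ℕ} [Fact p.Prime] {n : ℕ} (hn : 2 ≤ n)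
    {X : Type v} {S : Type u} [Group S] [TopologicalSpace S] [IsTopologicalGroup S]
    [CompactSpace S] [T2Space S] [TotallyDisconnectedSpace S]
    (ι : X → S) (hS : IsFreeProfiniteOn ι)
    (N : Subgroup S) [N.Normal] (hN : IsClosed (N : Set S)) (hNS : N ≤ zassenhaus p S n) :
    homKernel (Unitriangular (n - 1) (ZMod p)) (S ⧸ N) = zassenhaus p (S ⧸ N) n ∧
    (homKernel (Unitriangular n (ZMod p)) (S ⧸ N) = zassenhaus p (S ⧸ N) (n + 1) ↔
      ∃ E ⊆ masseyElements n p ((S ⧸ N) ⧸ zassenhaus p (S ⧸ N) n),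
        AddSubgroup.closure E =
          masseySubgroup n p ((S ⧸ N) ⧸ zassenhaus p (S ⧸ N) n) ⊓
            (ContH2.inf (A := ZMod p) (zassenhaus p (S ⧸ N) n)).ker) := by
  have hp : p.Prime := Fact.out
  have hT2 : T2Space (S ⧸ N) := inferInstance
  let π : S →ₜ* S ⧸ N := quotientProj N
  have hπs : Function.Surjective π := QuotientGroup.mk_surjective
  have hmap : ∀ m, (zassenhaus p S m).map (π : S →* S ⧸ N) = zassenhaus p (S ⧸ N) m :=
    map_zassenhaus π hπs
  have hπmem : ∀ {m s}, s ∈ zassenhaus p S m → π s ∈ zassenhaus p (S ⧸ N) m := fun {m s} h =>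
    hmap m ▸ ⟨s, h, rfl⟩
  have ha : homKernel (Unitriangular (n - 1) (ZMod p)) (S ⧸ N) = zassenhaus p (S ⧸ N) n := by
    obtain ⟨m, rfl⟩ : ∃ m, n = m + 1 := ⟨n - 1, by omega⟩
    refine le_antisymm (fun g hg => ?_) Unitriangular.zassenhaus_le_homKernel
    obtain ⟨s, rfl⟩ := hπs g
    have := mem_homKernel_of_mk_mem hNS hg
    rw [hS.homKernel_unitriangular] at this
    exact hπmem this
  refine ⟨ha, ?_⟩
  let q : S ⧸ N →ₜ* (S ⧸ N) ⧸ zassenhaus p (S ⧸ N) n := quotientProj _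
  have hq : IsQuotientMap q := QuotientGroup.isQuotientMap_mk _
  have hπ : IsQuotientMap π := QuotientGroup.isQuotientMap_mk _
  have hqπ : IsQuotientMap (q.comp π) := hq.comp hπ
  have hkerq : ∀ g, q g = 1 ↔ g ∈ zassenhaus p (S ⧸ N) n := fun g => QuotientGroup.eq_one_iff g
  -- This is where `N ≤ S_n` identifies `G/G_n` with `S/S_n`.
  have hkerqπ : ∀ s, q.comp π s = 1 ↔ s ∈ zassenhaus p S n := fun s => by
    refine (hkerq (π s)).trans ⟨fun h => ?_, hπmem⟩
    rw [← hmap n] at h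
    obtain ⟨t, ht, hts⟩ := h
    have h1 : t⁻¹ * s ∈ N := QuotientGroup.eq.1 hts
    simpa using mul_mem ht (hNS h1)
  have hcharG : ∀ χ : C(S ⧸ N, ZMod p), (∀ a b, χ (a * b) = χ a + χ b) → ∀ k, q k = 1 → χ k = 0 :=
    fun χ hχ k hk => additive_eq_zero_of_mem_zassenhaus hn χ hχ ((hkerq k).1 hk)
  have hcharS : ∀ χ : C(S, ZMod p), (∀ a b, χ (a * b) = χ a + χ b) →
      ∀ k, q.comp π k = 1 → χ k = 0 :=
    fun χ hχ k hk => additive_eq_zero_of_mem_zassenhaus hn χ hχ ((hkerqπ k).1 hk)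
  have hSn := hS.homKernel_unitriangular (p := p) n
  constructor
  · intro hT
    refine ⟨{x ∈ masseyElements n p _ | ContH2.pullback q x = 0}, fun x hx => hx.1,
      le_antisymm (le_inf (AddSubgroup.closure_mono fun x hx => hx.1)
        ((AddSubgroup.closure_le _).2 fun x hx => hx.2)) ?_⟩
    rintro c ⟨hcM, hc0⟩
    obtain ⟨φ, hφ⟩ := IsTransgression.exists_of_pullback_eq_zero (q := q) (c := c) hc0
    have hinf : masseyElements n p ((S ⧸ N) ⧸ zassenhaus p (S ⧸ N) n) ⊆
        {x ∈ masseyElements n p _ | ContH2.pullback (q.comp π) x = 0} :=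
      fun x hx => ⟨hx, hS.pullback_massey_eq_zero (q.comp π) hx⟩
    -- Over `S` all Massey elements die, so `c` is also the transgression of a character of `S_n`
    -- trivial on `T_n(S) = S_(n+1)`. Uniqueness of the character transfers this to `φ` on
    -- `G_(n+1)`, which is `T_n(G)` by assumption.
    obtain ⟨φ', hφ', hφ'0⟩ := exists_isTransgression_of_mem_closure hn
      (AddSubgroup.closure_mono hinf hcM)
    obtain ⟨c', hc', ψ, hψ, hφψ⟩ := exists_mem_closure_isTransgression (q := q) hn hq hkerq
      (χ := φ) φ.continuous.continuousOn
      (fun a ha b _ => hφ.map_mul_left ((hkerq a).2 ha) b) (fun k _ hk => by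
        rw [hT, ← hmap] at hk
        obtain ⟨s, hs, rfl⟩ := hk
        have hs1 : q.comp π s = 1 := (hkerqπ s).2 (antitone_zassenhaus (Nat.le_succ n) hs)
        exact ((hφ.comp π).congr_of_eq hφ' hcharS hs1).trans (hφ'0 s (hSn ▸ hs) hs1))
    rw [hφ.eq_of_eqOn hq hψ fun k hk => hφψ k ((hkerq k).1 hk)]
    exact hc'
  · rintro ⟨E, hE, hEc⟩
    refine le_antisymm (fun g hg => ?_) Unitriangular.zassenhaus_le_homKernel
    have hgn : g ∈ zassenhaus p (S ⧸ N) n := by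
      rw [← ha]
      obtain ⟨m, rfl⟩ : ∃ m, n = m + 1 := ⟨n - 1, by omega⟩
      exact Unitriangular.homKernel_succ_le hg
    by_contra hgn1
    obtain ⟨s, rfl⟩ := hπs g
    have hs : s ∈ zassenhaus p S n := (hkerqπ s).1 ((hkerq _).2 hgn)
    -- `C` contains `N`, so a character trivial on `C ∩ S_n` descends to `G`; enlarging `C` by the
    -- open subgroup `U` makes the character continuous.
    let C : Subgroup S := (zassenhaus p (S ⧸ N) (n + 1)).comap (π : S →* S ⧸ N)
    have hC : IsClosed (C : Set S) := (isClosed_zassenhaus p _ _).preimage π.continuous_toFun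
    obtain ⟨U, -, hU, hsU⟩ := exists_open_normal_notMem_sup hC (s := s) hgn1
    have hZC : ∀ k ∈ zassenhaus p S (n + 1), k ∈ (C ⊔ U) ⊓ zassenhaus p S n := fun k hk =>
      ⟨Subgroup.mem_sup_left (hπmem hk), antitone_zassenhaus (Nat.le_succ n) hk⟩
    have hF := isRestrictedFiltration_zassenhaus (p := p) (G := S)
    obtain ⟨χ, hχ, hχ0, hχs⟩ := exists_additive_form (p := p) (K := zassenhaus p S n)
      (B := (C ⊔ U) ⊓ zassenhaus p S n)
      (fun a ha => hZC _ (hF.antitone (by nlinarith [hp.two_le]) (hF.pow_mem n a ha)))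
      (fun a ha b hb => hZC _ (hF.antitone (by omega) (hF.commutator_le n n
        (Subgroup.commutator_mem_commutator ha hb)))) inf_le_right hs (fun h => hsU h.1)
    obtain ⟨c, hc, φ, hφ, hχφ⟩ := exists_mem_closure_isTransgression (q := q.comp π) hn hqπ hkerqπ
      (continuousOn_of_additive hU hχ fun k hk hkU => hχ0 k ⟨Subgroup.mem_sup_right hkU, hk⟩) hχ
      (fun k _ hk => hχ0 k (hZC k (hSn ▸ hk)))
    obtain ⟨ψ, hψφ, hψ⟩ := hφ.exists_descend hπ fun k hk => by
      have hkN : k ∈ N := (QuotientGroup.eq_one_iff k).1 hk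
      rw [← hχφ k (hNS hkN)]
      refine hχ0 k ⟨Subgroup.mem_sup_left ?_, hNS hkN⟩
      change π k ∈ zassenhaus p (S ⧸ N) (n + 1)
      rw [hk]
      exact one_mem _
    have hcE : c ∈ AddSubgroup.closure E := by
      rw [hEc]
      exact ⟨AddSubgroup.closure_mono (fun x hx => hx.1) hc, hψ.pullback_eq_zero⟩
    -- Each member of `E` has trivial inflation, being in the kernel that `E` generates. So `c` is
    -- also the transgression of a character trivial on `T_n(G)`, which contains `π s`; yet the
    -- character of `c` takes the value `1` there.
    have hEq : E ⊆ {x ∈ masseyElements n p _ | ContH2.pullback q x = 0} := fun x hx =>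
      ⟨hE hx, (hEc.le (AddSubgroup.subset_closure hx)).2⟩
    obtain ⟨θ, hθ, hθ0⟩ := exists_isTransgression_of_mem_closure hn
      (AddSubgroup.closure_mono hEq hcE)
    have h1 : ψ (π s) = 0 :=
      (hψ.congr_of_eq hθ hcharG ((hkerq _).2 hgn)).trans (hθ0 _ hg ((hkerq _).2 hgn))
    rw [hψφ, ← hχφ s hs, hχs] at h1
    exact one_ne_zero h1
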